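/- Let $d\ge 1$ and $\mathcal E=\{\pm e_1,\dots,\pm e_d\}\subset\mathbb Z^d$. Let $p$ be a probability distribution on $\mathbb Z^d$ with $p(x)=0$ for $x\notin\mathcal E$ and $0<p(e)<1$ for all $e\in\mathcal E$, such that $\sum_{e\in\mathcal E}p(e)\,e=a\,e_1$ for some $a\in(0,1)$. Let $\mu$ be a probability distribution on $\{0,1,2,\dots\}$ and let $(\eta_x)_{x\in\mathbb Z^d\setminus\{0\}}$ be i.i.d. with law $\mu$. Consider the frog model on $\mathbb Z^d$ with initial configuration $\eta$: at time $0$ there is one active frog at the origin and, for every $x\ne0$, there are $\eta_x$ sleeping frogs at $x$. Each active frog performs, in discrete time, a random walk with i.i.d. steps of law $p$, independently of all other frogs and of $\eta$; when an active frog visits a site, all frogs sleeping there become active at once and start their walks from that site. Let $P$ be the annealed law of this process, i.e. the mixture $P=\int P_\eta\,\mu^{\otimes(\mathbb Z^d\setminus\{0\})}(d\eta)$ of the laws $P_\eta$ of the model with fixed initial configuration $\eta$. If $$\sum_{j=2}^\infty(\log j)^{\frac{d+1}{2}}\,\mu(\{j\})=\infty,$$ i.e. $\mathbb E_\mu\bigl[(\log^+\eta_x)^{(d+1)/2}\bigr]=\infty$,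 then the frog model is recurrent, i.e. $$P\bigl(0\text{ is visited infinitely often by active frogs}\bigr)=1 .$$ -/

import Mathlib

open MeasureTheory

noncomputable section

namespace FrogModel

/-- The vertices of the lattice `ℤ^d`. -/
abbrev Site (d : ℕ) : Type := Fin d → ℤ

/-- The unit steps `± e_j`, `j = 1, …, d`. -/
def unitSteps (d : ℕ) : Finset (Site d) :=
  Finset.univ.image (fun j : Fin d => (Pi.single j 1 : Site d)) ∪
    Finset.univ.image (fun j : Fin d => (Pi.single j (-1) : Site d))

/-- `p` is the step distribution of an irreducible nearest-neighbour random walk on `ℤ^d` with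
mean step `a e_1`, where `a ∈ (0,1)`. The first coordinate has index `0 : Fin d`. -/
structure IsRightDriftStep {d : ℕ} [NeZero d] (p : PMF (Site d)) (a : ℝ) : Prop where
  nearest_neighbour : ∀ x, x ∉ unitSteps d → p x = 0
  pos : ∀ e ∈ unitSteps d, 0 < p e
  lt_one : ∀ e ∈ unitSteps d, p e < 1
  a_pos : 0 < a
  a_lt_one : a < 1
  drift : ∑ e ∈ unitSteps d, (p e).toReal • (fun j => (e j : ℝ)) =
    a • (Pi.single 0 1 : Fin d → ℝ)

/-- Initial configurations: `η x` is the number of sleeping frogs at `x ≠ 0`. -/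
abbrev Config (d : ℕ) : Type := {x : Site d // x ≠ 0} → ℕ

/-- The driving randomness: `ω (x, i, k)` is the step number `k` that frog number `i` of site `x`
makes after its activation. -/
abbrev Steps (d : ℕ) : Type := Site d × ℕ × ℕ → Site d

/-- The number of frogs whose initial position is `x`: one (the initially active frog) at the
origin, and `η x` elsewhere. The frogs of `x` are numbered by the `i < frogCount η x`. -/
def frogCount {d : ℕ} (η : Config d) (x : Site d) : ℕ :=
  if h : x = 0 then 1 else η ⟨x, h⟩

/-- The position of frog number `i` of site `x`, `k` time units after its activation. -/
def walk {d : ℕ} (ω : Steps d) (x : Site d) (i k : ℕ) : Site d :=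
  x + ∑ l ∈ Finset.range k, ω (x, i, l)

open Classical in
/-- The evolution of the frog model. At time `n`, `age η ω n x = none` if no active frog has
visited `x` up to time `n` (so the frogs of `x` are asleep), and `age η ω n x = some k` if `x` was
first visited, and its frogs activated, at time `n - k`. At time `0` only the origin is active; a
site that has not been visited up to time `n` gets activated at time `n + 1` if one of the frogs
active at time `n` jumps to it. -/
def age {d : ℕ} (η : Config d) (ω : Steps d) : ℕ → Site d → Option ℕ
  | 0, x => if x = 0 then some 0 else none
  | n + 1, x =>
    match age η ω n x with
    | some k => some (k + 1)
    | none =>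
      if ∃ y k i, age η ω n y = some k ∧ i < frogCount η y ∧ walk ω y i (k + 1) = x then
        some 0
      else none

/-- At time `n` some active frog is at the vertex `x`. -/
def VisitedAt {d : ℕ} (η : Config d) (ω : Steps d) (n : ℕ) (x : Site d) : Prop :=
  ∃ y k i, age η ω n y = some k ∧ i < frogCount η y ∧ walk ω y i k = x

/-- The event that the origin is visited infinitely often. -/
def originVisitedInfinitelyOften (d : ℕ) : Set (Config d × Steps d) :=
  {z | {n : ℕ | VisitedAt z.1 z.2 n 0}.Infinite}

/-- The law of the driving randomness: all steps of all frogs are i.i.d. with law `p`. -/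
def stepsLaw {d : ℕ} (p : PMF (Site d)) : Measure (Steps d) :=
  Measure.infinitePi fun _ : Site d × ℕ × ℕ => p.toMeasure

/-- The product law `μ^{⊗ ℤ^d ∖ {0}}` of the initial configuration. -/
def configLaw (d : ℕ) (μ : Measure ℕ) [IsProbabilityMeasure μ] : Measure (Config d) :=
  Measure.infinitePi fun _ : {x : Site d // x ≠ 0} => μ

/-- The law `P_η` of the frog model with fixed initial configuration `η`. -/
def quenched {d : ℕ} (p : PMF (Site d)) (η : Config d) : Measure (Config d × Steps d) :=
  (stepsLaw p).map (Prod.mk η)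

instance {d : ℕ} (p : PMF (Site d)) : IsProbabilityMeasure (stepsLaw p) := by
  unfold stepsLaw; infer_instance

/-- The quenched laws depend measurably on `η`, so that their mixture below makes sense. -/
theorem measurable_quenched {d : ℕ} (p : PMF (Site d)) : Measurable (quenched p) :=
  Measurable.map_prodMk_left

/-- The annealed law `P = ∫ P_η ℙ_μ(dη)`. -/
def annealed {d : ℕ} (p : PMF (Site d)) (μ : Measure ℕ) [IsProbabilityMeasure μ] :
    Measure (Config d × Steps d) :=
  (configLaw d μ).bind (quenched p)

end FrogModel

end

/-! The natural set to be filled by the frogs is the paraboloid `z_1 > 0`, `z_i ^ 2 ≤ z_1` along the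
drift. The proof combines filling, restarting and returning.

Filling. If `z` lies in the paraboloid, then so does a box of sites behind `z`, of height of order
`√z_1`, lying from `z` on the side of the axis (`sub_mem_paraboloid`). By the law of large numbers
and reflection symmetry, a walk first meets each hyperplane inside a prescribed orthant, within
linear time, with probability bounded below. Summed over the heights of the box, the expected number
of its frogs that visit `z` is of order `√z_1` (`exists_sum_hitProb_lower_bound`). By independence
`z` is missed with probability at most of order `exp (-α √z_1)`, which is summable over the
paraboloid. The finitely many sites outside the small tail of this sum are reached directly from the
apex if it holds enough frogs. So a crowded site activates its whole paraboloid with probability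
close to one (`exists_annealed_spreadFails_le`).

Restarting. The law `μ` has unbounded support, so the initial frog meets a crowded site. The first
such site, at height `n`, is determined by the path of that frog and by frog counts at heights at
most `n`. The spread from it involves only counts above `n` and walks of frogs starting at height at
least `n`. The two are independent, and almost surely some paraboloid becomes active
(`ae_exists_active_paraboloid`).

Returning. A frog at `y` visits the origin with probability at least `c ^ |y|`, so about `c ^ (-2
|y|)` frogs at `y` suffice for all but finitely many `y`. A site carries that many once `log η_y`
exceeds a multiple of `|y|`. Since the paraboloid has at least of order `N ^ ((d+1)/2)` points at
distance of order `N` or less, the expected number of such sites in it is infinite exactly because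
of the moment hypothesis. The second Borel-Cantelli lemma provides infinitely many of them
(`ae_infinite_largeCount_le`). -/

/-! ### The dynamics -/

noncomputable section

namespace FrogModel

variable {d : ℕ}

/-- The site `x` is visited by an active frog at some time. -/
def Active (η : Config d) (ω : Steps d) (x : Site d) : Prop :=
  ∃ n, age η ω n x = some 0

/-- Frog number `i` of site `x` visits `z` when it is activated. -/
def Visits (ω : Steps d) (x : Site d) (i : ℕ) (z : Site d) : Prop :=
  ∃ k, walk ω x i k = z

theorem active_zero (η : Config d) (ω : Steps d) : Active η ω 0 := ⟨0, by simp [age]⟩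

theorem age_succ_of_some {η : Config d} {ω : Steps d} {n k : ℕ} {x : Site d}
    (h : age η ω n x = some k) : age η ω (n + 1) x = some (k + 1) := by
  rw [age, h]

theorem age_add_of_some {η : Config d} {ω : Steps d} {n k : ℕ} {x : Site d}
    (h : age η ω n x = some k) (j : ℕ) : age η ω (n + j) x = some (k + j) := by
  induction j with
  | zero => simpa using h
  | succ j ih => exact age_succ_of_some ih

theorem active_of_age {η : Config d} {ω : Steps d} {n k : ℕ} {x : Site d}
    (h : age η ω n x = some k) : Active η ω x := by
  induction n generalizing k with
  | zero =>
    refine ⟨0, ?_⟩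
    by_cases hx : x = 0 <;> simp_all [age]
  | succ n ih =>
    cases hn : age η ω n x with
    | some j => exact ih hn
    | none =>
      rw [age, hn] at h
      refine ⟨n + 1, ?_⟩
      rw [age, hn]
      dsimp only at h ⊢
      split_ifs at h ⊢ with h'
      rfl

/-- The sites visited by the frogs of an active site are active. -/
theorem Active.of_visits {η : Config d} {ω : Steps d} {x z : Site d} {i : ℕ}
    (hx : Active η ω x) (hi : i < frogCount η x) (hv : Visits ω x i z) : Active η ω z := by
  obtain ⟨n, hn⟩ := hx
  obtain ⟨k, hk⟩ := hv
  cases k with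
  | zero => exact ⟨n, by rw [← hk]; simpa [walk] using hn⟩
  | succ k =>
    have hage : age η ω (n + k) x = some k := by simpa using age_add_of_some hn k
    cases hz : age η ω (n + k) z with
    | some j => exact active_of_age hz
    | none =>
      refine ⟨n + k + 1, ?_⟩
      rw [age, hz]
      dsimp only
      rw [if_pos ⟨x, k, i, hage, hi, hk⟩]

/-- Each awake site holds finitely many frogs, so one time unit wakes only finitely many new sites.
-/
theorem finite_age_ne_none (η : Config d) (ω : Steps d) (n : ℕ) :
    {x | age η ω n x ≠ none}.Finite := by
  induction n with
  | zero =>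
    refine (Set.finite_singleton (0 : Site d)).subset fun x hx => ?_
    by_contra h
    exact hx (by simpa [age] using h)
  | succ n ih =>
    refine (ih.union (ih.biUnion fun y _ => (Set.finite_Iio (frogCount η y)).image
      fun i => walk ω y i ((age η ω n y).getD 0 + 1))).subset fun x hx => ?_
    by_cases hn : age η ω n x = none
    · right
      have hx' : age η ω (n + 1) x ≠ none := hx
      rw [age, hn] at hx'
      dsimp only at hx'
      split_ifs at hx' with h
      · obtain ⟨y, k, i, hy, hi, hw⟩ := h
        refine Set.mem_biUnion (show y ∈ {x | age η ω n x ≠ none} by simp [hy]) ⟨i, hi, ?_⟩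
        simpa [hy] using hw
      · exact absurd rfl hx'
    · exact Or.inl hn

/-- If infinitely many active sites have a frog that visits the origin, then the origin is visited
infinitely often. -/
theorem infinite_visitedAt_zero {η : Config d} {ω : Steps d}
    (h : {y | Active η ω y ∧ ∃ i < frogCount η y, Visits ω y i 0}.Infinite) :
    {n | VisitedAt η ω n 0}.Infinite := by
  intro hfin
  -- If no visit to the origin occurs after time `N`, every `y` in the given set is awake by time
  -- `N`, and only finitely many sites are.
  obtain ⟨N, hN⟩ := hfin.bddAbove
  refine h ((finite_age_ne_none η ω N).subset ?_)
  rintro y ⟨⟨n, hn⟩, i, hi, k, hk⟩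
  have hage : age η ω (n + k) y = some k := by simpa using age_add_of_some hn k
  have hle : n + k ≤ N := hN ⟨y, k, i, hage, hi, hk⟩
  obtain ⟨j, rfl⟩ := Nat.exists_eq_add_of_le hle
  simp [age_add_of_some hage j]

end FrogModel

end

/-! ### The path of a single frog -/

noncomputable section

namespace FrogModel

open ProbabilityTheory Filter Topology

variable {d : ℕ}

/-- The law of an i.i.d. sequence of steps with law `p`. -/
def pathLaw (p : PMF (Site d)) : Measure (ℕ → Site d) :=
  Measure.infinitePi fun _ : ℕ => p.toMeasure

instance (p : PMF (Site d)) : IsProbabilityMeasure (pathLaw p) := by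
  unfold pathLaw; infer_instance

/-- The position after `k` steps of the walk started at the origin with steps `ξ`. -/
def partialSum (ξ : ℕ → Site d) (k : ℕ) : Site d := ∑ l ∈ Finset.range k, ξ l

theorem walk_eq (ω : Steps d) (x : Site d) (i k : ℕ) :
    walk ω x i k = x + partialSum (fun l => ω (x, i, l)) k := rfl

theorem partialSum_succ' (ξ : ℕ → Site d) (k : ℕ) :
    partialSum ξ (k + 1) = ξ 0 + partialSum (fun l => ξ (l + 1)) k := by
  rw [partialSum, Finset.sum_range_succ', add_comm]; rfl

theorem partialSum_succ (ξ : ℕ → Site d) (k : ℕ) :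
    partialSum ξ (k + 1) = partialSum ξ k + ξ k := Finset.sum_range_succ _ _

@[fun_prop]
theorem measurable_partialSum (k : ℕ) : Measurable fun ξ : ℕ → Site d => partialSum ξ k := by
  unfold partialSum; fun_prop

theorem measurePreserving_path (p : PMF (Site d)) (x : Site d) (i : ℕ) :
    MeasurePreserving (fun (ω : Steps d) l => ω (x, i, l)) (stepsLaw p) (pathLaw p) :=
  ⟨by fun_prop, Measure.map_infinitePi_infinitePi_of_inj (f := fun l : ℕ => (x, i, l))
    (fun a b h => by simpa using h)⟩

theorem measurePreserving_shift (p : PMF (Site d)) :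
    MeasurePreserving (fun (ξ : ℕ → Site d) l => ξ (l + 1)) (pathLaw p) (pathLaw p) :=
  ⟨by fun_prop, Measure.map_infinitePi_infinitePi_of_inj (f := fun l : ℕ => l + 1)
    (add_left_injective 1)⟩

theorem iIndepFun_path (p : PMF (Site d)) :
    iIndepFun (fun (l : ℕ) (ξ : ℕ → Site d) => ξ l) (pathLaw p) :=
  iIndepFun_infinitePi (X := fun _ x => x) (by fun_prop)

theorem map_eval_pathLaw (p : PMF (Site d)) (l : ℕ) :
    (pathLaw p).map (fun ξ => ξ l) = p.toMeasure := Measure.infinitePi_map_eval _ _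

/-- The first step of the walk is independent of the following ones. -/
theorem pathLaw_cons (p : PMF (Site d)) (e : Site d) {A : Set (ℕ → Site d)}
    (hA : MeasurableSet A) :
    pathLaw p {ξ | ξ 0 = e ∧ (fun l => ξ (l + 1)) ∈ A} = p e * pathLaw p A := by
  let m : ℕ → MeasurableSpace (ℕ → Site d) := fun l =>
    MeasurableSpace.comap (fun ξ => ξ l) inferInstance
  have hle : ∀ l, m l ≤ inferInstanceAs (MeasurableSpace (ℕ → Site d)) := fun l =>
    (measurable_pi_apply l).comap_le
  have hind := indep_iSup_of_disjoint hle (iIndepFun_path p)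
    (S := {0}) (T := Set.Ioi 0) (by simp)
  have h0 : MeasurableSet[⨆ i ∈ ({0} : Set ℕ), m i] {ξ : ℕ → Site d | ξ 0 = e} := by
    rw [iSup_singleton]
    exact ⟨{e}, measurableSet_singleton e, rfl⟩
  have hsh : Measurable[⨆ i ∈ Set.Ioi 0, m i] fun (ξ : ℕ → Site d) l => ξ (l + 1) := by
    rw [@measurable_pi_iff]
    intro l
    exact (comap_measurable _).mono
      (le_iSup₂_of_le (f := fun i (_ : i ∈ Set.Ioi 0) => m i) (l + 1) (Nat.succ_pos l) le_rfl)
      le_rfl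
  have h1 := (Indep_iff _ _ _).1 hind _ _ h0 (hsh hA)
  have h2 : pathLaw p {ξ | ξ 0 = e} = p e := by
    have := map_eval_pathLaw p 0
    rw [← p.toMeasure_apply_singleton e (measurableSet_singleton e), ← this,
      Measure.map_apply (measurable_pi_apply 0) (measurableSet_singleton e)]
    rfl
  have h3 := (measurePreserving_shift p).measure_preimage hA.nullMeasurableSet
  rw [h2, h3] at h1
  exact h1

/-- The probability that the walk started at the origin visits `v`. -/
def hitProb (p : PMF (Site d)) (v : Site d) : ℝ :=
  (pathLaw p).real {ξ | ∃ k, partialSum ξ k = v}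

@[measurability]
theorem measurableSet_hit (v : Site d) :
    MeasurableSet {ξ : ℕ → Site d | ∃ k, partialSum ξ k = v} := by
  rw [Set.ofPred_exists]
  exact MeasurableSet.iUnion fun k => measurable_partialSum k (measurableSet_singleton v)

theorem stepsLaw_real_visits (p : PMF (Site d)) (x : Site d) (i : ℕ) (z : Site d) :
    (stepsLaw p).real {ω | Visits ω x i z} = hitProb p (z - x) := by
  have : {ω : Steps d | Visits ω x i z} =
      (fun (ω : Steps d) l => ω (x, i, l)) ⁻¹' {ξ | ∃ k, partialSum ξ k = z - x} := by
    ext ω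
    simp [Visits, walk_eq, eq_sub_iff_add_eq']
  rw [this, hitProb, Measure.real, Measure.real,
    (measurePreserving_path p x i).measure_preimage (measurableSet_hit _).nullMeasurableSet]

theorem hitProb_nonneg (p : PMF (Site d)) (v : Site d) : 0 ≤ hitProb p v := measureReal_nonneg

theorem hitProb_le_one (p : PMF (Site d)) (v : Site d) : hitProb p v ≤ 1 := measureReal_le_one

theorem hitProb_zero (p : PMF (Site d)) : hitProb p 0 = 1 := by
  have : {ξ : ℕ → Site d | ∃ k, partialSum ξ k = 0} = Set.univ :=
    Set.eq_univ_of_forall fun ξ => ⟨0, by simp [partialSum]⟩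
  simp [hitProb, this]

theorem mul_hitProb_le (p : PMF (Site d)) (e v : Site d) :
    (p e).toReal * hitProb p v ≤ hitProb p (e + v) := by
  rw [hitProb, Measure.real, ← ENNReal.toReal_mul, ← pathLaw_cons p e (measurableSet_hit v)]
  refine measureReal_mono ?_
  rintro ξ ⟨h0, k, hk⟩
  exact ⟨k + 1, by rw [partialSum_succ', h0, hk]⟩

/-- The `ℓ¹`-norm on the lattice. -/
def l1norm (x : Site d) : ℕ := ∑ i, (x i).natAbs

theorem single_mem_unitSteps (j : Fin d) : (Pi.single j 1 : Site d) ∈ unitSteps d := by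
  simp [unitSteps]

theorem single_neg_mem_unitSteps (j : Fin d) : (Pi.single j (-1) : Site d) ∈ unitSteps d := by
  simp [unitSteps]

theorem mem_unitSteps {e : Site d} : e ∈ unitSteps d ↔
    ∃ j, e = Pi.single j 1 ∨ e = Pi.single j (-1) := by
  simp only [unitSteps, Finset.mem_union, Finset.mem_image, Finset.mem_univ, true_and, eq_comm,
    exists_or]

theorem abs_le_one_of_mem_unitSteps {e : Site d} (he : e ∈ unitSteps d) (i : Fin d) :
    |e i| ≤ 1 := by
  obtain ⟨j, rfl | rfl⟩ := mem_unitSteps.1 he <;> by_cases h : i = j <;> simp [h]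

theorem exists_unitStep_l1norm {v : Site d} (hv : v ≠ 0) :
    ∃ e ∈ unitSteps d, l1norm v = l1norm (v - e) + 1 := by
  obtain ⟨j, hj⟩ := Function.ne_iff.1 hv
  have key : ∀ s : ℤ, (v j).natAbs = (v j - s).natAbs + 1 →
      l1norm v = l1norm (v - Pi.single j s) + 1 := by
    intro s hs
    unfold l1norm
    have : ∑ x ∈ Finset.univ.erase j, ((v - Pi.single j s : Site d) x).natAbs =
        ∑ x ∈ Finset.univ.erase j, (v x).natAbs :=
      Finset.sum_congr rfl fun i hi => by simp [Finset.ne_of_mem_erase hi]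
    have h1 := Finset.add_sum_erase Finset.univ (fun i => (v i).natAbs) (Finset.mem_univ j)
    have h2 := Finset.add_sum_erase Finset.univ
      (fun i => ((v - (Pi.single j s : Site d)) i).natAbs) (Finset.mem_univ j)
    rw [← h1, ← h2, this]
    simp only [Pi.sub_apply, Pi.single_eq_same]
    omega
  have hj' : v j ≠ 0 := hj
  rcases lt_or_gt_of_ne hj' with h | h
  · exact ⟨_, single_neg_mem_unitSteps j, key (-1) (by omega)⟩
  · exact ⟨_, single_mem_unitSteps j, key 1 (by omega)⟩

/-- The walk may follow a shortest lattice path to `v`, each step of which has probability at least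
`c`. -/
theorem pow_l1norm_le_hitProb {p : PMF (Site d)} {c : ℝ} (hc : 0 ≤ c)
    (hcp : ∀ e ∈ unitSteps d, c ≤ (p e).toReal) (v : Site d) : c ^ l1norm v ≤ hitProb p v := by
  induction hn : l1norm v generalizing v with
  | zero =>
    have : v = 0 := by
      by_contra h
      obtain ⟨e, -, he⟩ := exists_unitStep_l1norm h
      omega
    simp [this, hitProb_zero]
  | succ n ih =>
    have hv : v ≠ 0 := by rintro rfl; simp [l1norm] at hn
    obtain ⟨e, he, hl⟩ := exists_unitStep_l1norm hv
    calc c ^ (n + 1) = c * c ^ n := pow_succ' _ _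
      _ ≤ (p e).toReal * hitProb p (v - e) :=
        mul_le_mul (hcp e he) (ih _ (by omega)) (by positivity) ENNReal.toReal_nonneg
      _ ≤ hitProb p v := by simpa using mul_hitProb_le p e (v - e)

/-- The bound `1 / 2` makes `c⁻¹ ≥ 2`, so that powers of `c⁻¹` grow and `log c⁻¹` is positive. -/
theorem exists_step_lower_bound [NeZero d] {p : PMF (Site d)} {a : ℝ}
    (hp : IsRightDriftStep p a) :
    ∃ c : ℝ, 0 < c ∧ c ≤ 1 / 2 ∧ ∀ e ∈ unitSteps d, c ≤ (p e).toReal := by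
  have hne : (unitSteps d).Nonempty := ⟨_, single_mem_unitSteps 0⟩
  obtain ⟨e, he, hmin⟩ := (unitSteps d).exists_min_image (fun e => (p e).toReal) hne
  refine ⟨min (p e).toReal (1 / 2), lt_min ?_ (by norm_num), min_le_right _ _,
    fun e' he' => (min_le_left _ _).trans (hmin e' he')⟩
  exact ENNReal.toReal_pos (hp.pos e he).ne' (p.apply_ne_top e)

theorem ae_mem_unitSteps [NeZero d] {p : PMF (Site d)} {a : ℝ} (hp : IsRightDriftStep p a) :
    ∀ᵐ ξ ∂pathLaw p, ∀ l, ξ l ∈ unitSteps d := by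
  rw [ae_all_iff]
  intro l
  have h : ∀ᵐ x ∂p.toMeasure, x ∈ unitSteps d := by
    rw [ae_iff, PMF.toMeasure_apply_eq_zero_iff _ (Set.to_countable _).measurableSet,
      Set.disjoint_left]
    intro x hx hx'
    exact hx (hp.nearest_neighbour x hx')
  rw [← map_eval_pathLaw p l] at h
  exact ae_of_ae_map (measurable_pi_apply l).aemeasurable h

theorem abs_partialSum_le {ξ : ℕ → Site d} (hξ : ∀ l, ξ l ∈ unitSteps d) (k : ℕ) (i : Fin d) :
    |partialSum ξ k i| ≤ k := by
  induction k with
  | zero => simp [partialSum]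
  | succ k ih =>
    rw [partialSum_succ, Pi.add_apply]
    have := abs_le_one_of_mem_unitSteps (hξ k) i
    push_cast
    exact (abs_add_le _ _).trans (add_le_add ih this)

theorem integral_first_coordinate [NeZero d] {p : PMF (Site d)} {a : ℝ}
    (hp : IsRightDriftStep p a) :
    Integrable (fun x : Site d => (x 0 : ℝ)) p.toMeasure ∧
      ∫ x : Site d, (x 0 : ℝ) ∂p.toMeasure = a := by
  have hint : Integrable (fun x : Site d => (x 0 : ℝ)) p.toMeasure := by
    refine Integrable.of_bound (C := 1) (Measurable.of_discrete.aestronglyMeasurable) ?_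
    rw [ae_iff, PMF.toMeasure_apply_eq_zero_iff _ (Set.to_countable _).measurableSet,
      Set.disjoint_left]
    intro x hx hx'
    by_cases hxu : x ∈ unitSteps d
    · have := abs_le_one_of_mem_unitSteps hxu 0
      exact hx' (by rw [Real.norm_eq_abs]; exact_mod_cast this)
    · exact hx (hp.nearest_neighbour x hxu)
  refine ⟨hint, ?_⟩
  rw [PMF.integral_eq_tsum _ _ hint, tsum_eq_sum (s := unitSteps d)
    fun x hx => by simp [hp.nearest_neighbour x hx]]
  simpa [Finset.sum_apply] using congrFun hp.drift 0

theorem ae_tendsto_average [NeZero d] {p : PMF (Site d)} {a : ℝ} (hp : IsRightDriftStep p a) :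
    ∀ᵐ ξ ∂pathLaw p, Tendsto (fun n : ℕ => (partialSum ξ n 0 : ℝ) / n) atTop (𝓝 a) := by
  have hmeas : Measurable fun x : Site d => (x 0 : ℝ) := .of_discrete
  have hmap : ∀ l, Measure.map (fun ξ : ℕ → Site d => ((ξ l 0 : ℤ) : ℝ)) (pathLaw p) =
      p.toMeasure.map fun x => (x 0 : ℝ) := fun l => by
    rw [← map_eval_pathLaw p l, Measure.map_map hmeas (measurable_pi_apply l)]; rfl
  have hident : ∀ l, IdentDistrib (fun ξ : ℕ → Site d => ((ξ l 0 : ℤ) : ℝ))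
      (fun ξ => ((ξ 0 0 : ℤ) : ℝ)) (pathLaw p) (pathLaw p) := fun l =>
    ⟨(hmeas.comp (measurable_pi_apply l)).aemeasurable,
      (hmeas.comp (measurable_pi_apply 0)).aemeasurable, by rw [hmap, hmap]⟩
  obtain ⟨hint, hval⟩ := integral_first_coordinate hp
  have h0 : Integrable (fun ξ : ℕ → Site d => ((ξ 0 0 : ℤ) : ℝ)) (pathLaw p) := by
    rw [← map_eval_pathLaw p 0] at hint
    exact hint.comp_measurable (measurable_pi_apply 0)
  have hE : ∫ ξ, ((ξ 0 0 : ℤ) : ℝ) ∂pathLaw p = a := by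
    rw [← hval, ← map_eval_pathLaw p 0,
      integral_map (measurable_pi_apply 0).aemeasurable hmeas.aestronglyMeasurable]
  have := strong_law_ae_real (fun (l : ℕ) (ξ : ℕ → Site d) => ((ξ l 0 : ℤ) : ℝ)) h0
    (fun i j hij => ((iIndepFun_path p).indepFun hij).comp hmeas hmeas) hident
  rw [hE] at this
  filter_upwards [this] with ξ hξ
  simpa [partialSum, Finset.sum_apply] using hξ

/-- The coordinates other than the first one are symmetric. -/
theorem step_symm [NeZero d] {p : PMF (Site d)} {a : ℝ} (hp : IsRightDriftStep p a)
    {j : Fin d} (hj : j ≠ 0) : p (Pi.single j 1) = p (Pi.single j (-1)) := by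
  have h := congrFun hp.drift j
  have hdisj : Disjoint (Finset.univ.image (fun j : Fin d => (Pi.single j 1 : Site d)))
      (Finset.univ.image (fun j : Fin d => (Pi.single j (-1) : Site d))) := by
    rw [Finset.disjoint_left]
    intro x hx hx'
    simp only [Finset.mem_image, Finset.mem_univ, true_and] at hx hx'
    obtain ⟨i, rfl⟩ := hx
    obtain ⟨k, hk⟩ := hx'
    have := congrFun hk i
    simp only [Pi.single_apply, if_true] at this
    split_ifs at this; omega
  have hinj : ∀ s : ℤ, s ≠ 0 → Function.Injective fun j : Fin d => (Pi.single j s : Site d) := by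
    intro s hs i k hik
    have := congrFun hik i
    by_contra hne
    simp [hne, hs] at this
  rw [unitSteps, Finset.sum_union hdisj, Finset.sum_image fun _ _ _ _ h => hinj 1 (by simp) h,
    Finset.sum_image fun _ _ _ _ h => hinj (-1) (by simp) h] at h
  simp [Finset.sum_apply, Pi.single_apply, hj] at h
  rw [← ENNReal.toReal_eq_toReal_iff' (p.apply_ne_top _) (p.apply_ne_top _)]
  linarith

end FrogModel

end

/-! ### Passage through hyperplanes -/

noncomputable section

namespace FrogModel

open ProbabilityTheory Filter Topology

variable {d : ℕ} [NeZero d]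

/-- The walk with steps `ξ` reaches the hyperplane `x_1 = k` for the first time at time `t`. -/
def FirstAt (ξ : ℕ → Site d) (k : ℤ) (t : ℕ) : Prop :=
  partialSum ξ t 0 = k ∧ ∀ s < t, partialSum ξ s 0 < k

theorem FirstAt.unique {ξ : ℕ → Site d} {k : ℤ} {t t' : ℕ} (h : FirstAt ξ k t)
    (h' : FirstAt ξ k t') : t = t' := by
  rcases lt_trichotomy t t' with hlt | heq | hlt
  · exact absurd h.1 (h'.2 t hlt).ne
  · exact heq
  · exact absurd h'.1 (h.2 t' hlt).ne

/-- A nearest-neighbour walk cannot jump over a level, and `1 ≤ k` excludes the starting point. -/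
theorem exists_firstAt {ξ : ℕ → Site d} (hξ : ∀ l, ξ l ∈ unitSteps d) {k : ℤ} (hk : 1 ≤ k) {n : ℕ}
    (hn : k ≤ partialSum ξ n 0) : ∃ t ≤ n, FirstAt ξ k t := by
  classical
  have hex : ∃ t, k ≤ partialSum ξ t 0 := ⟨n, hn⟩
  refine ⟨Nat.find hex, Nat.find_min' hex hn, ?_, fun s hs => not_le.1 (Nat.find_min hex hs)⟩
  have hspec := Nat.find_spec hex
  cases ht : Nat.find hex with
  | zero =>
    rw [ht] at hspec
    simp [partialSum] at hspec
    omega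
  | succ t =>
    have hlt := Nat.find_min hex (m := t) (by omega)
    rw [ht, partialSum_succ, Pi.add_apply] at hspec
    rw [partialSum_succ, Pi.add_apply]
    have := (abs_le.1 (abs_le_one_of_mem_unitSteps (hξ t) 0)).2
    omega

theorem measurable_firstAt (k : ℤ) (t : ℕ) : Measurable fun ξ : ℕ → Site d => FirstAt ξ k t := by
  have h : ∀ s, Measurable fun ξ : ℕ → Site d => partialSum ξ s 0 := fun s =>
    (measurable_pi_apply 0).comp (measurable_partialSum s)
  unfold FirstAt
  refine Measurable.and (measurableSet_setOfPred.1 (h t (measurableSet_singleton k))) ?_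
  refine Measurable.forall fun s => Measurable.imp measurable_const ?_
  exact measurableSet_setOfPred.1 (h s (measurableSet_Iio (a := k)))

theorem ae_tendsto_first_coordinate {p : PMF (Site d)} {a : ℝ} (hp : IsRightDriftStep p a) :
    ∀ᵐ ξ ∂pathLaw p, ∀ᶠ n : ℕ in atTop, a / 2 * n ≤ partialSum ξ n 0 := by
  filter_upwards [ae_tendsto_average hp] with ξ hξ
  have ha := hp.a_pos
  filter_upwards [hξ.eventually_const_le (half_lt_self ha), eventually_gt_atTop 0] with n hn hn0
  rwa [le_div_iff₀ (by exact_mod_cast hn0)] at hn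

theorem ae_exists_firstAt {p : PMF (Site d)} {a : ℝ} (hp : IsRightDriftStep p a) :
    ∀ᵐ ξ ∂pathLaw p, ∀ k : ℤ, 1 ≤ k → ∃ t, FirstAt ξ k t := by
  filter_upwards [ae_tendsto_first_coordinate hp, ae_mem_unitSteps hp] with ξ hξ hu k hk
  have ha := hp.a_pos
  have h2 : ∀ᶠ n : ℕ in atTop, (k : ℝ) ≤ a / 2 * n :=
    (tendsto_natCast_atTop_atTop.const_mul_atTop (half_pos ha)).eventually_ge_atTop _
  obtain ⟨n, h1, h2⟩ := (hξ.and h2).exists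
  obtain ⟨t, -, ht⟩ := exists_firstAt hu hk (n := n) (by exact_mod_cast h2.trans h1)
  exact ⟨t, ht⟩

/-- By the law of large numbers, with probability at least `1 / 2` the speed is at least `a / 2`
from some deterministic time `N` on. -/
theorem exists_linear_passage_time {p : PMF (Site d)} {a : ℝ} (hp : IsRightDriftStep p a) :
    ∃ C : ℕ, ∀ k : ℕ, 1 ≤ k →
      1 / 2 ≤ (pathLaw p).real {ξ | ∃ t ≤ C * k, FirstAt ξ k t} := by
  have ha := hp.a_pos
  let A : ℕ → Set (ℕ → Site d) := fun N =>
    {ξ | ∀ n ≥ N, a / 2 * n ≤ partialSum ξ n 0}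
  have hmono : Monotone A := fun N N' hN ξ hξ n hn => hξ n (hN.trans hn)
  have hU : pathLaw p (⋃ N, A N) = 1 := by
    rw [← prob_compl_eq_zero_iff₀]
    · have := ae_tendsto_first_coordinate hp
      rw [ae_iff] at this
      convert this using 2
      ext ξ
      simp [A]
    · refine (MeasurableSet.iUnion fun N => ?_).nullMeasurableSet
      simp only [A, Set.ofPred_forall]
      refine MeasurableSet.iInter fun n => MeasurableSet.iInter fun _ => ?_
      have h : Measurable fun ξ : ℕ → Site d => ((partialSum ξ n 0 : ℤ) : ℝ) :=
        (Measurable.of_discrete (f := fun x : Site d => (x 0 : ℝ))).comp (measurable_partialSum n)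
      exact measurableSet_le measurable_const h
  have hlim := tendsto_measure_iUnion_atTop (μ := pathLaw p) hmono
  rw [hU] at hlim
  obtain ⟨N, hN⟩ := (hlim.eventually_const_le (u := 1 / 2) (by simp)).exists
  -- At speed `a / 2`, time `m * k` suffices for level `k`; the maximum with `N` puts the time past
  -- `N`.
  obtain ⟨m, hm⟩ := exists_nat_ge (2 / a)
  refine ⟨max N m, fun k hk => ?_⟩
  have h1 : (1 / 2 : ℝ) ≤ (pathLaw p).real (A N) := by
    rw [Measure.real]
    have := ENNReal.toReal_mono (measure_ne_top _ _) hN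
    simpa using this
  refine h1.trans ?_
  rw [Measure.real, Measure.real]
  refine ENNReal.toReal_mono (measure_ne_top _ _) (measure_mono_ae ?_)
  filter_upwards [ae_mem_unitSteps hp] with ξ hu hξ
  have hk' : (1 : ℝ) ≤ k := by exact_mod_cast hk
  refine exists_firstAt hu (by exact_mod_cast hk) ?_
  have h2 := hξ (max N m * k) (by nlinarith [le_max_left N m])
  have h3 : (k : ℝ) ≤ a / 2 * ((max N m * k : ℕ) : ℝ) := by
    have h4 : 2 / a ≤ ((max N m : ℕ) : ℝ) := hm.trans (by exact_mod_cast le_max_right N m)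
    have h5 : 1 ≤ a / 2 * ((max N m : ℕ) : ℝ) := by
      calc (1 : ℝ) = a / 2 * (2 / a) := by field_simp
        _ ≤ _ := by gcongr
    push_cast at h5 ⊢
    nlinarith
  exact_mod_cast h3.trans h2

/-- Reflection in the coordinates `i ≠ 0` with `σ i = -1`. -/
def flip (σ : Fin d → ℤˣ) (x : Site d) : Site d := fun i => if i = 0 then x i else σ i * x i

theorem flip_flip (σ : Fin d → ℤˣ) (x : Site d) : flip σ (flip σ x) = x := by
  ext i
  simp only [flip]
  split_ifs
  · rfl
  · rw [← mul_assoc, ← Units.val_mul, Int.units_mul_self, Units.val_one, one_mul]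

theorem flip_add (σ : Fin d → ℤˣ) (x y : Site d) : flip σ (x + y) = flip σ x + flip σ y := by
  ext i
  simp only [flip, Pi.add_apply]
  split_ifs <;> ring

theorem partialSum_flip (σ : Fin d → ℤˣ) (ξ : ℕ → Site d) (k : ℕ) :
    partialSum (fun l => flip σ (ξ l)) k = flip σ (partialSum ξ k) := by
  induction k with
  | zero => ext i; simp [partialSum, flip]
  | succ k ih => rw [partialSum_succ, partialSum_succ, flip_add, ih]

theorem flip_single (σ : Fin d → ℤˣ) (j : Fin d) (s : ℤ) :
    flip σ (Pi.single j s) = Pi.single j (if j = 0 then s else σ j * s) := by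
  ext i
  by_cases hij : i = j
  · subst hij; simp [flip]
  · simp [flip, hij]

theorem step_flip {p : PMF (Site d)} {a : ℝ} (hp : IsRightDriftStep p a) (σ : Fin d → ℤˣ)
    (x : Site d) : p (flip σ x) = p x := by
  have hmem : ∀ y : Site d, y ∈ unitSteps d → p (flip σ y) = p y := by
    intro y hy
    obtain ⟨j, rfl | rfl⟩ := mem_unitSteps.1 hy <;> rw [flip_single] <;> split_ifs with hj
    · rfl
    · rcases Int.units_eq_one_or (σ j) with h | h <;> simp [h, step_symm hp hj]
    · rfl
    · rcases Int.units_eq_one_or (σ j) with h | h <;> simp [h, step_symm hp hj]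
  by_cases hx : x ∈ unitSteps d
  · exact hmem x hx
  · by_cases hx' : flip σ x ∈ unitSteps d
    · have := hmem _ hx'
      rw [flip_flip] at this
      exact this.symm
    · rw [hp.nearest_neighbour _ hx, hp.nearest_neighbour _ hx']

theorem measurePreserving_flip {p : PMF (Site d)} {a : ℝ} (hp : IsRightDriftStep p a)
    (σ : Fin d → ℤˣ) :
    MeasurePreserving (fun (ξ : ℕ → Site d) l => flip σ (ξ l)) (pathLaw p) (pathLaw p) := by
  have hm : Measurable (flip σ) := .of_discrete
  have h1 : p.toMeasure.map (flip σ) = p.toMeasure := by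
    refine Measure.ext_of_singleton fun x => ?_
    rw [Measure.map_apply hm (measurableSet_singleton x)]
    have : flip σ ⁻¹' {x} = {flip σ x} := by
      ext y
      simp only [Set.mem_preimage, Set.mem_singleton_iff]
      constructor
      · rintro rfl; rw [flip_flip]
      · rintro rfl; rw [flip_flip]
    rw [this, p.toMeasure_apply_singleton _ (measurableSet_singleton _),
      p.toMeasure_apply_singleton _ (measurableSet_singleton _), step_flip hp]
  refine ⟨measurable_pi_lambda _ fun l => hm.comp (measurable_pi_apply l), ?_⟩
  rw [pathLaw, Measure.infinitePi_map_pi _ fun _ => hm]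
  simp only [h1]

/-- The walk reaches the hyperplane `x_1 = k` before time `R`, at a point whose coordinates `i ≠ 0`
have signs prescribed by `σ`, strictly for `i ∈ s`. -/
def passageEvent (k : ℤ) (R : ℕ) (σ : Fin d → ℤˣ) (s : Finset (Fin d)) : Set (ℕ → Site d) :=
  {ξ | ∃ t ≤ R, FirstAt ξ k t ∧
    ∀ i, i ≠ 0 → (if i ∈ s then 1 else 0) ≤ (σ i : ℤ) * partialSum ξ t i}

theorem measurableSet_passageEvent (k : ℤ) (R : ℕ) (σ : Fin d → ℤˣ) (s : Finset (Fin d)) :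
    MeasurableSet (passageEvent k R σ s) := by
  refine measurableSet_setOfPred.2 ?_
  refine Measurable.exists fun t => Measurable.and measurable_const
    ((measurable_firstAt k t).and ?_)
  exact (Measurable.of_discrete (f := fun x : Site d => ∀ i, i ≠ 0 →
    (if i ∈ s then 1 else 0) ≤ (σ i : ℤ) * x i)).comp (measurable_partialSum t)

/-- Every passage point lies in some closed orthant, and by reflection symmetry all sign patterns
are equally likely. The sign of coordinate `0` plays no role and only makes the factor larger than
necessary. -/
theorem measure_passageEvent_empty {p : PMF (Site d)} {a : ℝ} (hp : IsRightDriftStep p a)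
    (k : ℤ) (R : ℕ) (σ : Fin d → ℤˣ) :
    (pathLaw p).real {ξ | ∃ t ≤ R, FirstAt ξ k t} ≤
      2 ^ d * (pathLaw p).real (passageEvent k R σ ∅) := by
  have hpre : ∀ τ, (fun (ξ : ℕ → Site d) l => flip τ (ξ l)) ⁻¹' passageEvent k R 1 ∅ =
      passageEvent k R τ ∅ := by
    intro τ
    ext ξ
    simp only [passageEvent, FirstAt, Set.mem_preimage, Set.mem_ofPred_eq, partialSum_flip]
    refine exists_congr fun t => and_congr_right fun _ => and_congr ?_ ?_
    · simp [flip]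
    · refine forall_congr' fun i => forall_congr' fun hi => ?_
      simp [flip, hi]
  have heq : ∀ τ, (pathLaw p).real (passageEvent k R τ ∅) =
      (pathLaw p).real (passageEvent k R 1 ∅) := fun τ => by
    rw [← hpre τ, Measure.real, (measurePreserving_flip hp τ).measure_preimage
      (measurableSet_passageEvent _ _ _ _).nullMeasurableSet]
    rfl
  calc (pathLaw p).real {ξ | ∃ t ≤ R, FirstAt ξ k t}
      ≤ (pathLaw p).real (⋃ τ : Fin d → ℤˣ, passageEvent k R τ ∅) := by
        refine measureReal_mono ?_
        rintro ξ ⟨t, ht, hf⟩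
        refine Set.mem_iUnion.2 ⟨fun i => if 0 ≤ partialSum ξ t i then 1 else -1, t, ht, hf,
          fun i _ => ?_⟩
        simp only [Finset.notMem_empty, if_false]
        split_ifs with h
        · simpa using h
        · simp; omega
    _ ≤ ∑ τ : Fin d → ℤˣ, (pathLaw p).real (passageEvent k R τ ∅) :=
        measureReal_iUnion_fintype_le _
    _ = 2 ^ d * (pathLaw p).real (passageEvent k R σ ∅) := by
        simp [heq]

/-- Prepending the step `σ j e_j` makes the sign condition in direction `j` strict. It leaves the
first coordinate, hence the passage itself, unchanged and costs one time unit. -/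
theorem mul_measure_passageEvent_le (p : PMF (Site d)) {c : ℝ}
    (hcp : ∀ e ∈ unitSteps d, c ≤ (p e).toReal)
    {k : ℤ} (hk : 1 ≤ k) (R : ℕ) (σ : Fin d → ℤˣ) (s : Finset (Fin d)) {j : Fin d} (hj : j ≠ 0) :
    c * (pathLaw p).real (passageEvent k R σ s) ≤
      (pathLaw p).real (passageEvent k (R + 1) σ (insert j s)) := by
  have hmem : (Pi.single j (σ j : ℤ) : Site d) ∈ unitSteps d := by
    rcases Int.units_eq_one_or (σ j) with h | h <;> rw [h]
    · exact single_mem_unitSteps j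
    · exact single_neg_mem_unitSteps j
  calc c * (pathLaw p).real (passageEvent k R σ s)
      ≤ (p (Pi.single j (σ j : ℤ))).toReal * (pathLaw p).real (passageEvent k R σ s) :=
        mul_le_mul_of_nonneg_right (hcp _ hmem) measureReal_nonneg
    _ = (pathLaw p).real {ξ | ξ 0 = Pi.single j (σ j : ℤ) ∧
          (fun l => ξ (l + 1)) ∈ passageEvent k R σ s} := by
        rw [Measure.real, Measure.real, ← ENNReal.toReal_mul,
          pathLaw_cons p _ (measurableSet_passageEvent _ _ _ _)]
    _ ≤ _ := by
        refine measureReal_mono ?_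
        rintro ξ ⟨h0, t, ht, ⟨hf1, hf2⟩, hs⟩
        have hzero : ∀ y : Site d, ((Pi.single j (σ j : ℤ) : Site d) + y) 0 = y 0 := fun y => by
          simp [hj.symm]
        refine ⟨t + 1, by omega, ⟨?_, ?_⟩, ?_⟩
        · rw [partialSum_succ', h0, hzero, hf1]
        · rintro (_ | u) hu
          · simpa [partialSum] using Int.lt_of_lt_of_le zero_lt_one hk
          · rw [partialSum_succ', h0, hzero]
            exact hf2 u (by omega)
        · intro i hi
          have := hs i hi
          rw [partialSum_succ', h0, Pi.add_apply, mul_add]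
          by_cases hij : i = j
          · subst hij
            have h1 : (σ i : ℤ) * (σ i : ℤ) = 1 := by
              rw [← Units.val_mul, Int.units_mul_self, Units.val_one]
            simp only [Finset.mem_insert_self, if_true, Pi.single_eq_same, h1]
            split_ifs at this <;> omega
          · simpa [hij, Finset.mem_insert] using this

theorem pow_card_mul_measure_passageEvent_le (p : PMF (Site d)) {c : ℝ} (hc : 0 ≤ c)
    (hcp : ∀ e ∈ unitSteps d, c ≤ (p e).toReal)
    {k : ℤ} (hk : 1 ≤ k) (R : ℕ) (σ : Fin d → ℤˣ) (s : Finset (Fin d)) (hs : 0 ∉ s) :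
    c ^ s.card * (pathLaw p).real (passageEvent k R σ ∅) ≤
      (pathLaw p).real (passageEvent k (R + s.card) σ s) := by
  induction s using Finset.induction_on with
  | empty => simp
  | insert j s hjs ih =>
    have hj : j ≠ 0 := fun h => hs (by simp [h])
    have h0 : 0 ∉ s := fun h => hs (Finset.mem_insert_of_mem h)
    rw [Finset.card_insert_of_notMem hjs, pow_succ', mul_assoc]
    exact (mul_le_mul_of_nonneg_left (ih h0) hc).trans
      (mul_measure_passageEvent_le p hcp hk _ σ s hj)

/-- The walk reaches the hyperplane `x_1 = k` within a time that is linear in `k`, at a point in a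
prescribed orthant, with a probability bounded away from zero. -/
theorem exists_passage_lower_bound {p : PMF (Site d)} {a : ℝ} (hp : IsRightDriftStep p a) :
    ∃ C : ℕ, ∃ κ : ℝ, 0 < κ ∧ ∀ (k : ℕ) (σ : Fin d → ℤˣ), 1 ≤ k →
      κ ≤ (pathLaw p).real {ξ | ∃ t ≤ C * k + d, FirstAt ξ k t ∧
        ∀ i, i ≠ 0 → 1 ≤ (σ i : ℤ) * partialSum ξ t i} := by
  obtain ⟨C, hC⟩ := exists_linear_passage_time hp
  obtain ⟨c, hc0, -, hcp⟩ := exists_step_lower_bound hp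
  -- All transverse directions are made strict; this takes at most `d` additional steps, whence the
  -- `+ d` in the time bound.
  let s : Finset (Fin d) := Finset.univ.erase 0
  have hs : s.card ≤ d := by simp [s]
  refine ⟨C, c ^ s.card * (1 / 2 / 2 ^ d), by positivity, fun k σ hk => ?_⟩
  have h1 := (hC k hk).trans (measure_passageEvent_empty hp k (C * k) σ)
  calc c ^ s.card * (1 / 2 / 2 ^ d)
      ≤ c ^ s.card * (pathLaw p).real (passageEvent k (C * k) σ ∅) := by
        gcongr
        rw [div_le_iff₀' (by positivity)]
        exact h1
    _ ≤ (pathLaw p).real (passageEvent k (C * k + s.card) σ s) :=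
        pow_card_mul_measure_passageEvent_le p hc0.le hcp (by exact_mod_cast hk) _ σ s (by simp [s])
    _ ≤ _ := by
        refine measureReal_mono ?_
        rintro ξ ⟨t, ht, hf, hi⟩
        exact ⟨t, by omega, hf, fun i hi0 => by simpa [s, hi0] using hi i hi0⟩

/-- The expected number of points of `W` at height between `1` and `m` that are visited is of order
`m` if `W` contains a sufficiently large box in an orthant. -/
theorem exists_sum_hitProb_lower_bound {p : PMF (Site d)} {a : ℝ} (hp : IsRightDriftStep p a) :
    ∃ C : ℕ, ∃ κ : ℝ, 0 < κ ∧ ∀ (m : ℕ) (σ : Fin d → ℤˣ) (W : Finset (Site d)),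
      (∀ v : Site d, 1 ≤ v 0 → v 0 ≤ m →
        (∀ i, i ≠ 0 → 1 ≤ (σ i : ℤ) * v i ∧ (σ i : ℤ) * v i ≤ C * m + d) → v ∈ W) →
      m * κ ≤ ∑ v ∈ W, hitProb p v := by
  obtain ⟨C, κ, hκ, h⟩ := exists_passage_lower_bound hp
  refine ⟨C, κ, hκ, fun m σ W hW => ?_⟩
  have hlevel : ∀ k ∈ Finset.Icc 1 m, κ ≤ ∑ v ∈ W with v 0 = (k : ℤ), hitProb p v := by
    intro k hk
    obtain ⟨hk1, hkm⟩ := Finset.mem_Icc.1 hk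
    -- The first point on the hyperplane is unique, so these events are disjoint and their
    -- probabilities add up.
    let D : Site d → Set (ℕ → Site d) := fun v => {ξ | ∃ t, FirstAt ξ k t ∧ partialSum ξ t = v}
    have hDm : ∀ v, MeasurableSet (D v) := fun v => measurableSet_setOfPred.2 <|
      Measurable.exists fun t => (measurable_firstAt _ t).and
        (measurableSet_setOfPred.1 (measurable_partialSum t (measurableSet_singleton v)))
    calc κ ≤ _ := h k σ hk1
      _ ≤ (pathLaw p).real (⋃ v ∈ W.filter fun v => v 0 = (k : ℤ), D v) := by
        rw [Measure.real, Measure.real]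
        refine ENNReal.toReal_mono (measure_ne_top _ _) (measure_mono_ae ?_)
        filter_upwards [ae_mem_unitSteps hp] with ξ hu
        rintro ⟨t, ht, hf, hi⟩
        refine Set.mem_biUnion (x := partialSum ξ t) ?_ ⟨t, hf, rfl⟩
        simp only [Finset.coe_filter, Set.mem_ofPred_eq]
        refine ⟨hW _ (by rw [hf.1]; exact_mod_cast hk1) (by rw [hf.1]; exact_mod_cast hkm)
          fun i hi0 => ⟨hi i hi0, ?_⟩, hf.1⟩
        -- A walk of `t` steps moves each coordinate by at most `t`, so the passage point stays in
        -- the box.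
        have h1 := abs_partialSum_le hu t i
        have h2 : (σ i : ℤ) * partialSum ξ t i ≤ |partialSum ξ t i| := by
          rcases Int.units_eq_one_or (σ i) with h | h <;> rw [h]
          · simpa using le_abs_self _
          · simpa using neg_le_abs _
        have h3 : t ≤ C * m + d := ht.trans (by gcongr)
        have h4 : (t : ℤ) ≤ C * m + d := by exact_mod_cast h3
        omega
      _ = ∑ v ∈ W with v 0 = (k : ℤ), (pathLaw p).real (D v) := by
        refine measureReal_biUnion_finset ?_ fun v _ => hDm v
        intro v _ w _ hvw
        refine Set.disjoint_left.2 ?_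
        rintro ξ ⟨t, hf, ht⟩ ⟨t', hf', ht'⟩
        exact hvw (by rw [← ht, ← ht', hf.unique hf'])
      _ ≤ _ := Finset.sum_le_sum fun v _ => measureReal_mono (by
        rintro ξ ⟨t, -, ht⟩
        exact ⟨t, ht⟩)
  calc m * κ = ∑ _k ∈ Finset.Icc 1 m, κ := by simp
    _ ≤ ∑ k ∈ Finset.Icc 1 m, ∑ v ∈ W with v 0 = (k : ℤ), hitProb p v := Finset.sum_le_sum hlevel
    _ = ∑ v ∈ (Finset.Icc 1 m).biUnion fun k => W.filter fun v => v 0 = (k : ℤ), hitProb p v := by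
        refine (Finset.sum_biUnion ?_).symm
        intro k _ k' _ hkk
        refine Finset.disjoint_left.2 fun v hv hv' => hkk ?_
        have h1 := (Finset.mem_filter.1 hv).2
        have h2 := (Finset.mem_filter.1 hv').2
        omega
    _ ≤ ∑ v ∈ W, hitProb p v := by
        refine Finset.sum_le_sum_of_subset_of_nonneg ?_ fun v _ _ => hitProb_nonneg p v
        exact Finset.biUnion_subset.2 fun k _ => Finset.filter_subset _ _

end FrogModel

end

/-! ### Independence -/

noncomputable section

namespace FrogModel

open ProbabilityTheory Filter Topology

variable {d : ℕ}

theorem annealed_eq_prod (p : PMF (Site d)) (μ : Measure ℕ) [IsProbabilityMeasure μ] :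
    annealed p μ = (configLaw d μ).prod (stepsLaw p) := by
  rw [Measure.prod]; rfl

instance (μ : Measure ℕ) [IsProbabilityMeasure μ] : IsProbabilityMeasure (configLaw d μ) := by
  unfold configLaw; infer_instance

instance (p : PMF (Site d)) (μ : Measure ℕ) [IsProbabilityMeasure μ] :
    IsProbabilityMeasure (annealed p μ) := by
  rw [annealed_eq_prod]; infer_instance

/-- The index set of all the independent variables that drive the frog model. -/
abbrev Coord (d : ℕ) : Type := {x : Site d // x ≠ 0} ⊕ (Site d × ℕ × ℕ)

/-- The `σ`-algebra generated by one of the driving variables. -/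
abbrev coordAlgebra : Coord d → MeasurableSpace (Config d × Steps d)
  | Sum.inl x => MeasurableSpace.comap (fun z => z.1 x) inferInstance
  | Sum.inr s => MeasurableSpace.comap (fun z => z.2 s) inferInstance

/-- The `σ`-algebra generated by the driving variables with index in `I`. -/
abbrev sigmaOf (I : Set (Coord d)) : MeasurableSpace (Config d × Steps d) :=
  ⨆ j ∈ I, coordAlgebra j

theorem coordAlgebra_le (j : Coord d) :
    coordAlgebra j ≤ inferInstanceAs (MeasurableSpace (Config d × Steps d)) := by
  rcases j with x | s
  · exact ((measurable_pi_apply x).comp measurable_fst).comap_le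
  · exact ((measurable_pi_apply s).comp measurable_snd).comap_le

theorem sigmaOf_le (I : Set (Coord d)) :
    sigmaOf I ≤ inferInstanceAs (MeasurableSpace (Config d × Steps d)) :=
  iSup₂_le fun j _ => coordAlgebra_le j

theorem measurable_config {I : Set (Coord d)} {x : {x : Site d // x ≠ 0}} (hx : Sum.inl x ∈ I) :
    Measurable[sigmaOf I] fun z : Config d × Steps d => z.1 x :=
  (comap_measurable (fun z : Config d × Steps d => z.1 x)).mono
    (le_iSup₂_of_le (f := fun j (_ : j ∈ I) => coordAlgebra j) _ hx le_rfl) le_rfl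

theorem measurable_step {I : Set (Coord d)} {s : Site d × ℕ × ℕ} (hs : Sum.inr s ∈ I) :
    Measurable[sigmaOf I] fun z : Config d × Steps d => z.2 s :=
  (comap_measurable (fun z : Config d × Steps d => z.2 s)).mono
    (le_iSup₂_of_le (f := fun j (_ : j ∈ I) => coordAlgebra j) _ hs le_rfl) le_rfl

/-- Splitting a finite index set into its configuration part and its step part turns the
intersection into a product of two cylinders, whose probability factorises. -/
theorem iIndep_coordAlgebra (p : PMF (Site d)) (μ : Measure ℕ) [IsProbabilityMeasure μ] :
    iIndep coordAlgebra (annealed p μ) := by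
  classical
  rw [iIndep_iff]
  intro s f hf
  have hL : ∀ x : {x : Site d // x ≠ 0}, ∃ t : Set ℕ, Sum.inl x ∈ s →
      f (Sum.inl x) = ((fun η : Config d => η x) ⁻¹' t) ×ˢ Set.univ := by
    intro x
    by_cases hx : Sum.inl x ∈ s
    · obtain ⟨t, -, ht⟩ := hf _ hx
      exact ⟨t, fun _ => by rw [← ht]; ext z; simp⟩
    · exact ⟨∅, fun h => absurd h hx⟩
  have hR : ∀ x : Site d × ℕ × ℕ, ∃ t : Set (Site d), Sum.inr x ∈ s →
      f (Sum.inr x) = Set.univ ×ˢ ((fun ω : Steps d => ω x) ⁻¹' t) := by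
    intro x
    by_cases hx : Sum.inr x ∈ s
    · obtain ⟨t, -, ht⟩ := hf _ hx
      exact ⟨t, fun _ => by rw [← ht]; ext z; simp⟩
    · exact ⟨∅, fun h => absurd h hx⟩
  choose tL htL using hL
  choose tR htR using hR
  have hinter : ⋂ i ∈ s, f i = ((s.toLeft : Set _).pi tL) ×ˢ ((s.toRight : Set _).pi tR) := by
    ext z
    simp only [Set.mem_iInter, Set.mem_prod, Set.mem_pi, Finset.mem_coe, Finset.mem_toLeft,
      Finset.mem_toRight]
    constructor
    · intro h
      refine ⟨fun x hx => ?_, fun x hx => ?_⟩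
      · have := h _ hx
        rw [htL x hx] at this
        exact this.1
      · have := h _ hx
        rw [htR x hx] at this
        exact this.2
    · rintro ⟨h1, h2⟩ (x | x) hx
      · rw [htL x hx]; exact ⟨h1 x hx, trivial⟩
      · rw [htR x hx]; exact ⟨trivial, h2 x hx⟩
  have hprod : ∏ i ∈ s, annealed p μ (f i) =
      (∏ x ∈ s.toLeft, μ (tL x)) * ∏ x ∈ s.toRight, p.toMeasure (tR x) := by
    conv_lhs => rw [← Finset.toLeft_disjSum_toRight (u := s), Finset.prod_disjSum]
    congr 1
    · refine Finset.prod_congr rfl fun x hx => ?_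
      rw [htL x (Finset.mem_toLeft.1 hx), annealed_eq_prod, Measure.prod_prod, measure_univ,
        mul_one]
      exact (measurePreserving_eval_infinitePi (fun _ : {x : Site d // x ≠ 0} => μ)
        x).measure_preimage MeasurableSet.of_discrete.nullMeasurableSet
    · refine Finset.prod_congr rfl fun x hx => ?_
      rw [htR x (Finset.mem_toRight.1 hx), annealed_eq_prod, Measure.prod_prod, measure_univ,
        one_mul]
      exact (measurePreserving_eval_infinitePi (fun _ : Site d × ℕ × ℕ => p.toMeasure)
        x).measure_preimage MeasurableSet.of_discrete.nullMeasurableSet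
  rw [hinter, hprod, annealed_eq_prod, Measure.prod_prod, configLaw, stepsLaw,
    Measure.infinitePi_pi _ fun _ _ => .of_discrete, Measure.infinitePi_pi _ fun _ _ => .of_discrete]

theorem measure_inter_of_disjoint (p : PMF (Site d)) (μ : Measure ℕ) [IsProbabilityMeasure μ]
    {I J : Set (Coord d)} (hIJ : Disjoint I J) {A B : Set (Config d × Steps d)}
    (hA : MeasurableSet[sigmaOf I] A) (hB : MeasurableSet[sigmaOf J] B) :
    annealed p μ (A ∩ B) = annealed p μ A * annealed p μ B :=
  (Indep_iff _ _ _).1 (indep_iSup_of_disjoint coordAlgebra_le (iIndep_coordAlgebra p μ) hIJ)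
    _ _ hA hB

theorem sigmaOf_mono {I J : Set (Coord d)} (h : I ⊆ J) : sigmaOf I ≤ sigmaOf J :=
  biSup_mono h

theorem measureReal_biInter_of_disjoint (p : PMF (Site d)) (μ : Measure ℕ)
    [IsProbabilityMeasure μ] {ι : Type*} (s : Finset ι) {I : ι → Set (Coord d)}
    (hI : Pairwise (Function.onFun Disjoint I)) {A : ι → Set (Config d × Steps d)}
    (hA : ∀ y ∈ s, MeasurableSet[sigmaOf (I y)] (A y)) :
    (annealed p μ).real (⋂ y ∈ s, A y) = ∏ y ∈ s, (annealed p μ).real (A y) := by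
  classical
  induction s using Finset.induction_on with
  | empty => simp
  | insert y s hy ih =>
    rw [Finset.set_biInter_insert, Finset.prod_insert hy,
      ← ih fun w hw => hA w (Finset.mem_insert_of_mem hw), Measure.real,
      measure_inter_of_disjoint p μ (I := I y) (J := ⋃ w ∈ s, I w) ?_
        (hA y (Finset.mem_insert_self y s)) ?_, ENNReal.toReal_mul]
    · rfl
    · rw [Set.disjoint_iUnion₂_right]
      exact fun w hw => hI (fun h => hy (h ▸ hw))
    · refine Finset.measurableSet_biInter (m := sigmaOf (⋃ w ∈ s, I w)) _ fun w hw => ?_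
      exact sigmaOf_mono (Set.subset_biUnion_of_mem (u := fun w => I w) hw) _
        (hA w (Finset.mem_insert_of_mem hw))

theorem measurable_walk {I : Set (Coord d)} {x : Site d} {i : ℕ}
    (h : ∀ l, Sum.inr (x, i, l) ∈ I) (k : ℕ) :
    Measurable[sigmaOf I] fun z : Config d × Steps d => walk z.2 x i k := by
  unfold walk
  refine Measurable.add (@measurable_const _ _ _ (sigmaOf I) _) ?_
  exact Finset.measurable_sum (m := sigmaOf I) _ fun l _ => measurable_step (h l)

theorem measurable_path {I : Set (Coord d)} {x : Site d} {i : ℕ}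
    (h : ∀ l, Sum.inr (x, i, l) ∈ I) :
    Measurable[sigmaOf I] fun (z : Config d × Steps d) l => z.2 (x, i, l) :=
  @measurable_pi_lambda _ _ _ (sigmaOf I) _ _ fun l => measurable_step (h l)

theorem measurableSet_visits {I : Set (Coord d)} {x : Site d} {i : ℕ}
    (h : ∀ l, Sum.inr (x, i, l) ∈ I) (v : Site d) :
    MeasurableSet[sigmaOf I] {z : Config d × Steps d | Visits z.2 x i v} := by
  simp only [Visits, Set.ofPred_exists]
  exact @MeasurableSet.iUnion _ _ (sigmaOf I) _ _ fun k =>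
    measurable_walk h k (measurableSet_singleton v)

theorem measurableSet_le_config {I : Set (Coord d)} {x : {x : Site d // x ≠ 0}}
    (hx : Sum.inl x ∈ I) (K : ℕ) :
    MeasurableSet[sigmaOf I] {z : Config d × Steps d | K ≤ z.1 x} :=
  measurable_config hx (measurableSet_Ici (a := K))

theorem annealed_real_visits (p : PMF (Site d)) (μ : Measure ℕ) [IsProbabilityMeasure μ]
    (x : Site d) (i : ℕ) (v : Site d) :
    (annealed p μ).real {z | Visits z.2 x i v} = hitProb p (v - x) := by
  have : {z : Config d × Steps d | Visits z.2 x i v} = Set.univ ×ˢ {ω | Visits ω x i v} := by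
    ext; simp
  rw [← stepsLaw_real_visits p x i v, this, annealed_eq_prod, Measure.real, Measure.prod_prod,
    measure_univ, one_mul, Measure.real]

theorem configLaw_le_config (μ : Measure ℕ) [IsProbabilityMeasure μ] (x : {x : Site d // x ≠ 0})
    (K : ℕ) : configLaw d μ {η | K ≤ η x} = μ (Set.Ici K) :=
  (measurePreserving_eval_infinitePi (fun _ : {x : Site d // x ≠ 0} => μ)
    x).measure_preimage (s := Set.Ici K) measurableSet_Ici.nullMeasurableSet

theorem annealed_real_le_config (p : PMF (Site d)) (μ : Measure ℕ) [IsProbabilityMeasure μ]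
    (x : {x : Site d // x ≠ 0}) (K : ℕ) :
    (annealed p μ).real {z | K ≤ z.1 x} = μ.real (Set.Ici K) := by
  have : {z : Config d × Steps d | K ≤ z.1 x} = {η | K ≤ η x} ×ˢ Set.univ := by
    ext; simp
  rw [Measure.real, this, annealed_eq_prod, Measure.prod_prod, measure_univ, mul_one,
    configLaw_le_config, Measure.real]

/-- If `∑ μ([K n, ∞)) = ∞`, then infinitely many of the distinct sites `f n` carry at least `K n`
frogs. -/
theorem ae_frequently_le_config (μ : Measure ℕ) [IsProbabilityMeasure μ]
    {f : ℕ → {x : Site d // x ≠ 0}} (hf : Function.Injective f) {K : ℕ → ℕ}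
    (hK : ∑' n, μ (Set.Ici (K n)) = ⊤) :
    ∀ᵐ η ∂configLaw d μ, ∃ᶠ n in atTop, K n ≤ η (f n) := by
  have hm : ∀ n, MeasurableSet {η : Config d | K n ≤ η (f n)} := fun n =>
    measurable_pi_apply (f n) (measurableSet_Ici (a := K n))
  have hind : iIndepSet (fun n => {η : Config d | K n ≤ η (f n)}) (configLaw d μ) := by
    have h : iIndepFun (fun n (η : Config d) => η (f n)) (configLaw d μ) :=
      (iIndepFun_infinitePi (P := fun _ : {x : Site d // x ≠ 0} => μ) (X := fun _ x => x)
        (by fun_prop)).precomp hf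
    rw [iIndepSet_iff_meas_biInter hm]
    intro s
    exact h.measure_inter_preimage_eq_mul s (sets := fun n => Set.Ici (K n)) fun n _ =>
      measurableSet_Ici
  -- Second Borel-Cantelli lemma; injectivity of `f` gave the independence.
  have h1 := measure_limsup_eq_one hm hind (by simpa only [configLaw_le_config] using hK)
  have h2 : ∀ᵐ η ∂configLaw d μ, η ∈ limsup (fun n => {η : Config d | K n ≤ η (f n)}) atTop := by
    rw [← prob_compl_eq_zero_iff (MeasurableSet.measurableSet_limsup hm)] at h1
    exact h1
  filter_upwards [h2] with η hη
  rwa [mem_limsup_iff_frequently_mem] at hη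

end FrogModel

end

/-! ### Failure probabilities -/

noncomputable section

namespace FrogModel

open ProbabilityTheory Filter Topology

variable {d : ℕ}

theorem tsum_prod_fin (d : ℕ) (g : ℤ → ENNReal) :
    ∑' y : Fin d → ℤ, ∏ i, g (y i) = (∑' k, g k) ^ d := by
  induction d with
  | zero => simp
  | succ d ih =>
    rw [← (Fin.consEquiv fun _ => ℤ).tsum_eq, ENNReal.tsum_prod', pow_succ', ← ih,
      ← ENNReal.tsum_mul_right]
    refine tsum_congr fun k => ?_
    rw [← ENNReal.tsum_mul_left]
    refine tsum_congr fun y => ?_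
    simp [Fin.consEquiv, Fin.prod_univ_succ]

theorem summable_exp_neg_sqrt_nat {β : ℝ} (hβ : 0 < β) :
    Summable fun n : ℕ => Real.exp (-(β * √n)) := by
  -- The fourth-order term of the exponential series gives `exp (β √n) ≥ β ^ 4 n ^ 2 / 4!`.
  have hs : Summable fun n : ℕ => 24 / β ^ 4 * (1 / (n : ℝ) ^ 2) :=
    (Real.summable_one_div_nat_pow.2 (by norm_num)).mul_left _
  refine Summable.of_norm_bounded_eventually_nat hs ?_
  filter_upwards [eventually_gt_atTop 0] with n hn
  have hn' : (0 : ℝ) < n := by exact_mod_cast hn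
  have h1 := Real.pow_div_factorial_le_exp (β * √n) (by positivity) 4
  have h2 : (β * √n) ^ 4 = β ^ 4 * (n : ℝ) ^ 2 := by
    rw [mul_pow, show √(n : ℝ) ^ 4 = (√(n : ℝ) ^ 2) ^ 2 by ring, Real.sq_sqrt hn'.le]
  rw [h2, show ((Nat.factorial 4 : ℕ) : ℝ) = 24 by norm_num [Nat.factorial]] at h1
  rw [Real.norm_eq_abs, abs_of_pos (Real.exp_pos _), Real.exp_neg]
  calc (Real.exp (β * √n))⁻¹ ≤ (β ^ 4 * (n : ℝ) ^ 2 / 24)⁻¹ := inv_anti₀ (by positivity) h1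
    _ = 24 / β ^ 4 * (1 / (n : ℝ) ^ 2) := by field_simp

/-- As `|y i| ≤ |y|` for each coordinate, the summand is at most a product of one-dimensional terms
with rate `α / (d + 1)`; the `+ 1` avoids dividing by zero when `d = 0`. -/
theorem tsum_exp_neg_sqrt_l1norm_ne_top (d : ℕ) {α : ℝ} (hα : 0 < α) :
    ∑' y : Site d, ENNReal.ofReal (Real.exp (-(α * √(l1norm y)))) ≠ ⊤ := by
  have hd : (0 : ℝ) < d + 1 := by positivity
  let β := α / (d + 1)
  have hβ : 0 < β := by positivity
  let g : ℤ → ENNReal := fun k => ENNReal.ofReal (Real.exp (-(β * √(k.natAbs))))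
  have hg : ∑' k, g k ≠ ⊤ := by
    have : Summable fun k : ℤ => Real.exp (-(β * √(k.natAbs))) := by
      refine Summable.of_nat_of_neg ?_ ?_ <;> simpa using summable_exp_neg_sqrt_nat hβ
    exact this.tsum_ofReal_ne_top
  refine ne_top_of_le_ne_top (b := ∑' y : Site d, ∏ i, g (y i)) ?_ (ENNReal.tsum_le_tsum fun y => ?_)
  · rw [tsum_prod_fin]
    exact ENNReal.pow_ne_top hg
  · rw [← ENNReal.ofReal_prod_of_nonneg fun i _ => (Real.exp_pos _).le, ← Real.exp_sum]
    refine ENNReal.ofReal_le_ofReal (Real.exp_le_exp.2 ?_)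
    rw [Finset.sum_neg_distrib, neg_le_neg_iff]
    calc ∑ i, β * √((y i).natAbs) ≤ ∑ _i : Fin d, β * √(l1norm y) := by
          refine Finset.sum_le_sum fun i _ => ?_
          gcongr
          exact Finset.single_le_sum (f := fun i => (y i).natAbs) (fun _ _ => Nat.zero_le _)
            (Finset.mem_univ i)
      _ = d * β * √(l1norm y) := by simp [mul_assoc]
      _ ≤ α * √(l1norm y) := by
          gcongr
          calc (d : ℝ) * β ≤ (d + 1) * β := by gcongr; linarith
            _ = α := by simp only [β]; field_simp

theorem prod_one_sub_le_exp {ι : Type*} (s : Finset ι) (f : ι → ℝ) (hf : ∀ i ∈ s, f i ≤ 1) :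
    ∏ i ∈ s, (1 - f i) ≤ Real.exp (-∑ i ∈ s, f i) := by
  rw [← Finset.sum_neg_distrib, Real.exp_sum]
  refine Finset.prod_le_prod (fun i hi => sub_nonneg.2 (hf i hi)) fun i _ => ?_
  have := Real.add_one_le_exp (-f i)
  linarith

/-- The probability that none of the first `K` frogs of `x` visits `v`. -/
theorem annealed_real_forall_not_visits_le (p : PMF (Site d)) (μ : Measure ℕ)
    [IsProbabilityMeasure μ] (x v : Site d) (K : ℕ) :
    (annealed p μ).real {z | ∀ i < K, ¬ Visits z.2 x i v} ≤
      Real.exp (-(K * hitProb p (v - x))) := by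
  let I : ℕ → Set (Coord d) := fun i => {j | ∃ l, j = Sum.inr (x, i, l)}
  have hI : Pairwise (Function.onFun Disjoint I) := by
    intro i i' hii
    refine Set.disjoint_left.2 ?_
    rintro j ⟨l, rfl⟩ ⟨l', h⟩
    simp_all
  have hm : ∀ i, MeasurableSet[sigmaOf (I i)] {z : Config d × Steps d | Visits z.2 x i v} :=
    fun i => measurableSet_visits (I := I i) (fun l => ⟨l, rfl⟩) v
  have h := measureReal_biInter_of_disjoint p μ (Finset.range K) hI
    (A := fun i => {z : Config d × Steps d | Visits z.2 x i v}ᶜ)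
    fun i _ => @MeasurableSet.compl _ _ (sigmaOf (I i)) (hm i)
  have heq : {z : Config d × Steps d | ∀ i < K, ¬ Visits z.2 x i v} =
      ⋂ i ∈ Finset.range K, {z : Config d × Steps d | Visits z.2 x i v}ᶜ := by
    ext z; simp
  rw [heq, h, Finset.prod_congr rfl fun i _ => by
    rw [probReal_compl_eq_one_sub (sigmaOf_le _ _ (hm i)), annealed_real_visits p μ]]
  refine (prod_one_sub_le_exp _ _ fun i _ => hitProb_le_one p _).trans_eq ?_
  simp

/-- The number of frogs at `y` that suffices to send one of them to the origin, up to a summable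
probability of failure. -/
def largeCount (c : ℝ) (y : Site d) : ℕ := ⌈(c⁻¹) ^ (2 * l1norm y)⌉₊

theorem l1norm_neg (y : Site d) : l1norm (-y) = l1norm y := by simp [l1norm]

/-- First Borel-Cantelli lemma. Among `c ^ (-2 |y|)` frogs, each succeeding with probability at
least `c ^ |y|`, the expected number of successes is at least `c ^ (-|y|) ≥ 2 ^ |y|`. Bounding this
below by `√|y|` is crude but lets the same summability statement serve here and for the paraboloid.
-/
theorem ae_finite_not_visits_zero (p : PMF (Site d)) (μ : Measure ℕ) [IsProbabilityMeasure μ]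
    {c : ℝ} (hc0 : 0 < c) (hc : c ≤ 1 / 2) (hcp : ∀ e ∈ unitSteps d, c ≤ (p e).toReal) :
    ∀ᵐ z ∂annealed p μ, {y | ∀ i < largeCount c y, ¬ Visits z.2 y i 0}.Finite := by
  refine ae_finite_setOfPred_mem
    (s := fun y => {z : Config d × Steps d | ∀ i < largeCount c y, ¬ Visits z.2 y i 0}) ?_
  refine ne_top_of_le_ne_top (tsum_exp_neg_sqrt_l1norm_ne_top d one_pos)
    (ENNReal.tsum_le_tsum fun y => ?_)
  rw [← ofReal_measureReal]
  refine ENNReal.ofReal_le_ofReal ((annealed_real_forall_not_visits_le p μ y 0 _).trans ?_)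
  rw [Real.exp_le_exp, neg_le_neg_iff, one_mul, zero_sub]
  have h1 : c ^ l1norm y ≤ hitProb p (-y) := by
    simpa [l1norm_neg] using pow_l1norm_le_hitProb hc0.le hcp (-y)
  have h2 : (c⁻¹) ^ (2 * l1norm y) ≤ (largeCount c y : ℝ) := Nat.le_ceil _
  have h3 : (2 : ℝ) ≤ c⁻¹ := by
    rw [le_inv_comm₀ (by norm_num) hc0]; linarith
  calc √(l1norm y : ℝ) ≤ l1norm y := by
        rw [Real.sqrt_le_left (by positivity)]
        exact_mod_cast Nat.le_self_pow (by norm_num) _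
    _ ≤ 2 ^ l1norm y := by exact_mod_cast (Nat.lt_two_pow_self).le
    _ ≤ (c⁻¹) ^ l1norm y := by gcongr
    _ = (c⁻¹) ^ (2 * l1norm y) * c ^ l1norm y := by
        rw [two_mul, pow_add, mul_assoc, ← mul_pow, inv_mul_cancel₀ hc0.ne', one_pow, mul_one]
    _ ≤ _ := by gcongr

variable [NeZero d]

/-- The lattice points of a paraboloid along the drift direction, without its apex. -/
def paraboloid (d : ℕ) [NeZero d] : Set (Site d) := {z | 0 < z 0 ∧ ∀ i, i ≠ 0 → z i ^ 2 ≤ z 0}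

theorem l1norm_le_of_mem_paraboloid {z : Site d} (hz : z ∈ paraboloid d) :
    (l1norm z : ℤ) ≤ d * z 0 := by
  have h : ∀ i, ((z i).natAbs : ℤ) ≤ z 0 := by
    intro i
    rw [Int.natCast_natAbs]
    by_cases hi : i = 0
    · rw [hi, abs_of_pos hz.1]
    · have h1 := hz.2 i hi
      have h2 : |z i| ≤ z i ^ 2 := by
        rw [← sq_abs]; exact Int.le_self_sq _
      exact h2.trans h1
  unfold l1norm
  rw [Nat.cast_sum]
  calc ∑ i, ((z i).natAbs : ℤ) ≤ ∑ _i : Fin d, z 0 := Finset.sum_le_sum fun i _ => h i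
    _ = d * z 0 := by simp

/-- The orthant of a point of the paraboloid, moved towards the axis, stays in the paraboloid. -/
theorem sub_mem_paraboloid {z v : Site d} (hz : z ∈ paraboloid d) {C m r : ℕ}
    (hr : (r : ℤ) ^ 2 ≤ z 0) (hr' : z 0 < (r + 1) ^ 2) (hm : (C + 1) * m + d + 1 ≤ r)
    (hv1 : 1 ≤ v 0) (hvm : v 0 ≤ m)
    (hv : ∀ i, i ≠ 0 → 1 ≤ ((if 0 ≤ z i then 1 else -1 : ℤˣ) : ℤ) * v i ∧
      ((if 0 ≤ z i then 1 else -1 : ℤˣ) : ℤ) * v i ≤ C * m + d) :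
    z - v ∈ paraboloid d := by
  have hd : 1 ≤ d := Nat.one_le_iff_ne_zero.2 (NeZero.ne d)
  have hm' : (C : ℤ) * m + m + d + 1 ≤ r := by
    have : C * m + m + d + 1 ≤ r := by linarith
    exact_mod_cast this
  have hCm : (0 : ℤ) ≤ C * m := by positivity
  have hd' : (1 : ℤ) ≤ d := by exact_mod_cast hd
  -- Losing height `v 0 ≤ m` may shrink the admissible transverse radius from `r` to `r - 1`. Each
  -- transverse coordinate makes up for it by moving at least one unit towards the axis, and
  -- overshoots by at most `C m + d ≤ r - 1`. This is why strict signs are required of the passage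
  -- points.
  have hlow : ((r : ℤ) - 1) ^ 2 ≤ z 0 - v 0 := by nlinarith
  refine ⟨?_, fun i hi => ?_⟩
  · have : (0 : ℤ) < ((r : ℤ) - 1) ^ 2 := by
      have : (1 : ℤ) ≤ r - 1 := by linarith
      positivity
    simp only [Pi.sub_apply]
    omega
  · refine le_trans ?_ hlow
    have hzi := hz.2 i hi
    have hzr : |z i| ≤ r := by
      have : |z i| < r + 1 := by
        refine abs_lt_of_sq_lt_sq (by linarith) (by positivity)
      omega
    obtain ⟨h1, h2⟩ := hv i hi
    rw [abs_le] at hzr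
    rw [Pi.sub_apply]
    refine sq_le_sq' ?_ ?_ <;> split_ifs at h1 h2 with h <;> simp at h1 h2 <;> linarith

end FrogModel

end

/-! ### Activation of paraboloids -/

noncomputable section

namespace FrogModel

open ProbabilityTheory Filter Topology

variable {d : ℕ}

theorem frogCount_of_ne {η : Config d} {x : Site d} (hx : x ≠ 0) : frogCount η x = η ⟨x, hx⟩ :=
  dif_neg hx

theorem measurableSet_le_frogCount {I : Set (Coord d)} {x : Site d}
    (hx : ∀ h : x ≠ 0, Sum.inl ⟨x, h⟩ ∈ I) (K : ℕ) :
    MeasurableSet[sigmaOf I] {z : Config d × Steps d | K ≤ frogCount z.1 x} := by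
  by_cases h : x = 0
  · simp only [frogCount, h, dite_true]
    exact @MeasurableSet.const _ (sigmaOf I) _
  · simp only [frogCount_of_ne h]
    exact measurableSet_le_config (hx h) K

variable [NeZero d]

/-- No frog with index `0` of a lower site of the paraboloid with apex `x` visits `x + z`. -/
def unreached (x z : Site d) : Set (Config d × Steps d) :=
  {w | ∀ y ∈ paraboloid d, y 0 < z 0 →
    ¬ (1 ≤ frogCount w.1 (x + y) ∧ Visits w.2 (x + y) 0 (x + z))}

/-- For distinct `v` in `W`, the events that `x + z - v` is occupied and its frog `0` visits `x + z`
involve disjoint sets of variables. All of them must fail. The condition `0 ≤ x 0` keeps these sites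
away from the origin, where the frog count is not random. -/
theorem annealed_real_unreached_le_exp (p : PMF (Site d)) (μ : Measure ℕ) [IsProbabilityMeasure μ]
    {x : Site d} (hx : 0 ≤ x 0) (z : Site d) (W : Finset (Site d))
    (hW : ∀ v ∈ W, z - v ∈ paraboloid d ∧ 0 < v 0) :
    (annealed p μ).real (unreached x z) ≤
      Real.exp (-(μ.real (Set.Ici 1) * ∑ v ∈ W, hitProb p v)) := by
  let I : Site d → Set (Coord d) := fun v =>
    {j | (∃ h, j = Sum.inl ⟨x + (z - v), h⟩) ∨ ∃ l, j = Sum.inr (x + (z - v), 0, l)}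
  have hI : Pairwise (Function.onFun Disjoint I) := by
    intro v v' hvv
    refine Set.disjoint_left.2 ?_
    rintro j (⟨h, rfl⟩ | ⟨l, rfl⟩) (⟨h', h2⟩ | ⟨l', h2⟩)
    · simp only [Sum.inl.injEq, Subtype.mk.injEq, add_right_inj, sub_right_inj] at h2
      exact hvv h2
    · simp at h2
    · simp at h2
    · simp only [Sum.inr.injEq, Prod.mk.injEq, add_right_inj, sub_right_inj] at h2
      exact hvv h2.1
  let A : Site d → Set (Config d × Steps d) := fun v =>
    {w | 1 ≤ frogCount w.1 (x + (z - v))} ∩ {w | Visits w.2 (x + (z - v)) 0 (x + z)}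
  have hA1 : ∀ v, MeasurableSet[sigmaOf (I v)]
      {w : Config d × Steps d | 1 ≤ frogCount w.1 (x + (z - v))} := fun v =>
    measurableSet_le_frogCount (I := I v) (fun h => Or.inl ⟨h, rfl⟩) 1
  have hA2 : ∀ v, MeasurableSet[sigmaOf (I v)]
      {w : Config d × Steps d | Visits w.2 (x + (z - v)) 0 (x + z)} := fun v =>
    measurableSet_visits (I := I v) (fun l => Or.inr ⟨l, rfl⟩) _
  have hA : ∀ v, MeasurableSet[sigmaOf (I v)] (A v) := fun v =>
    @MeasurableSet.inter _ (sigmaOf (I v)) _ _ (hA1 v) (hA2 v)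
  have hval : ∀ v ∈ W, (annealed p μ).real (A v) = μ.real (Set.Ici 1) * hitProb p v := by
    intro v hv
    have hne : x + (z - v) ≠ 0 := by
      intro h
      have h1 := congrFun h 0
      have h2 := (hW v hv).1.1
      simp only [Pi.add_apply, Pi.zero_apply] at h1
      omega
    have h := measure_inter_of_disjoint p μ
      (I := {j | j = Sum.inl ⟨x + (z - v), hne⟩})
      (J := {j | ∃ l, j = Sum.inr (x + (z - v), 0, l)})
      (A := {w : Config d × Steps d | 1 ≤ frogCount w.1 (x + (z - v))})
      (B := {w : Config d × Steps d | Visits w.2 (x + (z - v)) 0 (x + z)})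
      (Set.disjoint_left.2 (by rintro j rfl ⟨l, hl⟩; simp at hl))
      (measurableSet_le_frogCount (fun _ => rfl) 1)
      (measurableSet_visits (I := {j | ∃ l, j = Sum.inr (x + (z - v), 0, l)}) (fun l => ⟨l, rfl⟩) _)
    have h1 : (annealed p μ).real {w : Config d × Steps d | 1 ≤ frogCount w.1 (x + (z - v))} =
        μ.real (Set.Ici 1) := by
      simp only [frogCount_of_ne hne]
      exact annealed_real_le_config p μ _ 1
    have h2 := annealed_real_visits p μ (x + (z - v)) 0 (x + z)
    rw [show x + z - (x + (z - v)) = v by abel] at h2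
    rw [← h1, ← h2, Measure.real, h, ENNReal.toReal_mul]
    rfl
  calc (annealed p μ).real (unreached x z)
      ≤ (annealed p μ).real (⋂ v ∈ W, (A v)ᶜ) := by
        refine measureReal_mono fun w hw => ?_
        simp only [Set.mem_iInter]
        intro v hv hAv
        refine hw _ (hW v hv).1 ?_ hAv
        have := (hW v hv).2
        simp only [Pi.sub_apply]
        omega
    _ = ∏ v ∈ W, (1 - μ.real (Set.Ici 1) * hitProb p v) := by
        rw [measureReal_biInter_of_disjoint p μ W hI
          fun v _ => @MeasurableSet.compl _ _ (sigmaOf (I v)) (hA v)]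
        refine Finset.prod_congr rfl fun v hv => ?_
        rw [probReal_compl_eq_one_sub (sigmaOf_le _ _ (hA v)), hval v hv]
    _ ≤ _ := by
        refine (prod_one_sub_le_exp _ _ fun v _ => ?_).trans_eq (by rw [Finset.mul_sum])
        exact mul_le_one₀ measureReal_le_one (hitProb_nonneg p v) (hitProb_le_one p v)

/-- A box of displacements of height `m` of order `√(z 0)` fits behind `z`, and the hitting
probabilities over it sum to at least `m κ`. -/
theorem exists_annealed_real_unreached_le {p : PMF (Site d)} {a : ℝ} (hp : IsRightDriftStep p a)
    (μ : Measure ℕ) [IsProbabilityMeasure μ] (hμ : 0 < μ.real (Set.Ici 1)) :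
    ∃ α B : ℝ, 0 < α ∧ ∀ x z : Site d, 0 ≤ x 0 → z ∈ paraboloid d →
      (annealed p μ).real (unreached x z) ≤ Real.exp (B - α * √(z 0)) := by
  classical
  obtain ⟨C, κ, hκ, hsum⟩ := exists_sum_hitProb_lower_bound hp
  set q := μ.real (Set.Ici 1)
  have hC : (0 : ℝ) < C + 1 := by positivity
  -- The constant `B` absorbs the rounding loss in `√(z 0) / (C + 1) ≤ m + (d + 2) / (C + 1) + 1`.
  refine ⟨q * κ / (C + 1), q * κ * ((d + 2) / (C + 1) + 1), by positivity, fun x z hx hz => ?_⟩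
  obtain ⟨n, hn⟩ := Int.eq_ofNat_of_zero_le hz.1.le
  set r := Nat.sqrt n
  have hr1 : r ^ 2 ≤ n := Nat.sqrt_le' n
  have hr2 : n < (r + 1) ^ 2 := Nat.lt_succ_sqrt' n
  -- The largest height allowed by `sub_mem_paraboloid`. For small `r` truncated subtraction yields
  -- `m = 0`, where the bound is trivial.
  set m := (r - d - 1) / (C + 1)
  have hexp : (annealed p μ).real (unreached x z) ≤ Real.exp (-(q * (m * κ))) := by
    by_cases hm : m = 0
    · simp [hm]
    have hm' : (C + 1) * m + d + 1 ≤ r := by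
      have h1 : (C + 1) * m ≤ r - d - 1 := Nat.mul_div_le _ _
      have h2 : 0 < (C + 1) * m := by positivity
      omega
    -- Any cube containing the required box would do; it only serves to make `W` finite.
    let b : ℤ := C * m + d + m
    let W : Finset (Site d) := (Fintype.piFinset fun _ : Fin d => Finset.Icc (-b) b).filter
      fun v => z - v ∈ paraboloid d ∧ 0 < v 0
    have hW := hsum m (fun i => if 0 ≤ z i then 1 else -1) W ?_
    · refine (annealed_real_unreached_le_exp p μ hx z W fun v hv => (Finset.mem_filter.1 hv).2).trans
        (Real.exp_le_exp.2 (neg_le_neg ?_))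
      gcongr
    · intro v hv1 hvm hv
      have hmem := sub_mem_paraboloid hz (C := C) (m := m) (r := r) (by rw [hn]; exact_mod_cast hr1)
        (by rw [hn]; exact_mod_cast hr2) hm' hv1 hvm hv
      refine Finset.mem_filter.2 ⟨Fintype.mem_piFinset.2 fun i => Finset.mem_Icc.2 ?_, hmem,
        by omega⟩
      have hCm : (0 : ℤ) ≤ C * m := by positivity
      by_cases hi : i = 0
      · subst hi
        constructor <;> simp only [b] <;> linarith
      · obtain ⟨h1, h2⟩ := hv i hi
        constructor <;> simp only [b] <;> split_ifs at h1 h2 <;> simp at h1 h2 <;> linarith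
  refine hexp.trans (Real.exp_le_exp.2 ?_)
  have h1 : √((z 0 : ℤ) : ℝ) ≤ r + 1 := by
    rw [Real.sqrt_le_left (by positivity), hn]
    exact_mod_cast hr2.le
  have h2 : r ≤ (C + 1) * m + C + d + 1 := by
    have := Nat.div_add_mod (r - d - 1) (C + 1)
    have h3 := Nat.mod_lt (r - d - 1) (by omega : 0 < C + 1)
    have h4 : r - d - 1 = (C + 1) * m + (r - d - 1) % (C + 1) := this.symm
    omega
  have h3 : (r : ℝ) ≤ (C + 1) * m + C + d + 1 := by exact_mod_cast h2
  have h4 : √((z 0 : ℤ) : ℝ) / (C + 1) ≤ m + ((d + 2) / (C + 1) + 1) := by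
    rw [div_le_iff₀ hC]
    have : ((m : ℝ) + ((d + 2) / (C + 1) + 1)) * (C + 1) = m * (C + 1) + ((d + 2) + (C + 1)) := by
      field_simp
    rw [this]
    linarith
  have h5 := mul_le_mul_of_nonneg_left h4 (by positivity : 0 ≤ q * κ)
  calc -(q * (m * κ)) = q * κ * ((d + 2) / (C + 1) + 1) -
        q * κ * (m + ((d + 2) / (C + 1) + 1)) := by ring
    _ ≤ q * κ * ((d + 2) / (C + 1) + 1) - q * κ * (√((z 0 : ℤ) : ℝ) / (C + 1)) := by linarith
    _ = _ := by ring

/-- Some site of `x + t` is missed by the first `M` frogs of `x`, or some other site of the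
paraboloid with apex `x` is not visited by the frogs of lower sites. -/
def spreadFails (t : Finset (Site d)) (M : ℕ) (x : Site d) : Set (Config d × Steps d) :=
  (⋃ z ∈ t, {w | ∀ i < M, ¬ Visits w.2 x i (x + z)}) ∪
    ⋃ z ∈ {z | z ∈ paraboloid d ∧ z ∉ t}, unreached x z

/-- Strong induction on height: a site outside `t` is visited from a strictly lower site of the same
paraboloid, and sites of `t` are visited from the apex. -/
theorem active_of_notMem_spreadFails {t : Finset (Site d)} {M : ℕ} {x : Site d}
    {w : Config d × Steps d} (hx : Active w.1 w.2 x) (hM : M ≤ frogCount w.1 x)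
    (hw : w ∉ spreadFails t M x) {z : Site d} (hz : z ∈ paraboloid d) :
    Active w.1 w.2 (x + z) := by
  simp only [spreadFails, Set.mem_union, Set.mem_iUnion, not_or, not_exists] at hw
  induction hn : (z 0).toNat using Nat.strong_induction_on generalizing z with
  | _ n ih =>
    by_cases hzt : z ∈ t
    · have h := hw.1 z hzt
      simp only [Set.mem_ofPred_eq, not_forall, not_not] at h
      obtain ⟨i, hi, hv⟩ := h
      exact hx.of_visits (hi.trans_le hM) hv
    · have h := hw.2 z ⟨hz, hzt⟩
      simp only [unreached, Set.mem_ofPred_eq, not_forall, not_not] at h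
      obtain ⟨y, hy, hyz, hc, hv⟩ := h
      refine (ih (y 0).toNat ?_ hy rfl).of_visits hc hv
      have := hy.1
      omega

/-- If `x` has sufficiently many frogs, then with high probability the activation of `x` entails the
activation of all sites in the paraboloid with apex `x`. -/
theorem exists_annealed_spreadFails_le {p : PMF (Site d)} {a : ℝ} (hp : IsRightDriftStep p a)
    (μ : Measure ℕ) [IsProbabilityMeasure μ] (hμ : 0 < μ.real (Set.Ici 1)) {δ : ENNReal}
    (hδ : 0 < δ) :
    ∃ (t : Finset (Site d)) (M : ℕ), ∀ x : Site d, 0 ≤ x 0 →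
      annealed p μ (spreadFails t M x) ≤ δ := by
  obtain ⟨α, B, hα, hB⟩ := exists_annealed_real_unreached_le hp μ hμ
  obtain ⟨c, hc0, -, hcp⟩ := exists_step_lower_bound hp
  have hd : (0 : ℝ) < d := by exact_mod_cast Nat.pos_of_ne_zero (NeZero.ne d)
  have hδ2 : 0 < δ / 2 := ENNReal.half_pos hδ.ne'
  -- A summable bound that does not depend on the apex, obtained from `|z| ≤ d z_1` on the
  -- paraboloid. It fixes `t` through its tail; `M` is chosen afterwards so that the apex reaches
  -- all of `t`.
  let g : Site d → ENNReal := fun z =>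
    ENNReal.ofReal (Real.exp B) * ENNReal.ofReal (Real.exp (-(α / √d * √(l1norm z))))
  have hg : ∑' z, g z ≠ ⊤ := by
    rw [ENNReal.tsum_mul_left]
    exact ENNReal.mul_ne_top ENNReal.ofReal_ne_top
      (tsum_exp_neg_sqrt_l1norm_ne_top d (by positivity))
  have hle : ∀ x z : Site d, 0 ≤ x 0 → z ∈ paraboloid d → annealed p μ (unreached x z) ≤ g z := by
    intro x z hx hz
    simp only [g]
    rw [← ofReal_measureReal, ← ENNReal.ofReal_mul (Real.exp_pos _).le, ← Real.exp_add]
    refine ENNReal.ofReal_le_ofReal ((hB x z hx hz).trans (Real.exp_le_exp.2 ?_))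
    have h1 : (l1norm z : ℝ) ≤ d * z 0 := by exact_mod_cast l1norm_le_of_mem_paraboloid hz
    have h2 : √(l1norm z : ℝ) ≤ √d * √(z 0) := by
      rw [← Real.sqrt_mul hd.le]
      exact Real.sqrt_le_sqrt h1
    have h3 : α / √d * √(l1norm z) ≤ α * √(z 0) := by
      rw [div_mul_eq_mul_div, div_le_iff₀ (by positivity)]
      nlinarith
    linarith
  obtain ⟨t, ht⟩ := ((ENNReal.tendsto_tsum_compl_atTop_zero hg).eventually_le_const hδ2).exists
  have hM : Tendsto (fun M : ℕ => ∑ z ∈ t, ENNReal.ofReal (Real.exp (-(M * hitProb p z)))) atTop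
      (𝓝 (∑ _z ∈ t, 0)) := by
    refine tendsto_finsetSum _ fun z _ => ?_
    have hz : 0 < hitProb p z := lt_of_lt_of_le (by positivity) (pow_l1norm_le_hitProb hc0.le hcp z)
    rw [← ENNReal.ofReal_zero]
    refine ENNReal.tendsto_ofReal (Real.tendsto_exp_neg_atTop_nhds_zero.comp ?_)
    exact tendsto_natCast_atTop_atTop.atTop_mul_const hz
  rw [Finset.sum_const_zero] at hM
  obtain ⟨M, hM⟩ := (hM.eventually_le_const hδ2).exists
  refine ⟨t, M, fun x hx => ?_⟩
  calc annealed p μ (spreadFails t M x)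
      ≤ annealed p μ (⋃ z ∈ t, {w | ∀ i < M, ¬ Visits w.2 x i (x + z)}) +
        annealed p μ (⋃ z ∈ {z | z ∈ paraboloid d ∧ z ∉ t}, unreached x z) := measure_union_le _ _
    _ ≤ δ / 2 + δ / 2 := by
        refine add_le_add (le_trans (measure_biUnion_finset_le _ _) (le_trans ?_ hM)) ?_
        · refine Finset.sum_le_sum fun z _ => ?_
          rw [← ofReal_measureReal]
          refine ENNReal.ofReal_le_ofReal ?_
          simpa using annealed_real_forall_not_visits_le p μ x (x + z) M
        · refine le_trans (measure_biUnion_le _ (Set.to_countable _) _) (le_trans ?_ ht)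
          calc ∑' z : {z | z ∈ paraboloid d ∧ z ∉ t}, annealed p μ (unreached x z)
              ≤ ∑' z : {z | z ∈ paraboloid d ∧ z ∉ t}, g z :=
                ENNReal.tsum_le_tsum fun z => hle x z hx z.2.1
            _ ≤ ∑' z : {z // z ∉ t}, g z :=
                ENNReal.tsum_mono_subtype g (fun z hz => hz.2)
    _ = δ := ENNReal.add_halves δ

end FrogModel

end

/-! ### Sites with many frogs -/

noncomputable section

namespace FrogModel

open ProbabilityTheory Filter Topology

variable {d : ℕ}

/-- Under bounded support the logarithmic moment would be finite. -/
theorem measure_Ici_pos {μ : Measure ℕ} [IsProbabilityMeasure μ] {s : ℝ} (hs : 0 ≤ s)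
    (hμ : ∫⁻ j : ℕ, ENNReal.ofReal (Real.posLog (j : ℝ) ^ s) ∂μ = ⊤) (K : ℕ) :
    0 < μ (Set.Ici K) := by
  rw [pos_iff_ne_zero]
  intro h0
  have hae : ∀ᵐ j ∂μ, j < K := by
    rw [ae_iff]
    convert h0 using 2
    ext j
    simp
  have hle : ∫⁻ j : ℕ, ENNReal.ofReal (Real.posLog (j : ℝ) ^ s) ∂μ ≤
      ∫⁻ _j : ℕ, ENNReal.ofReal (Real.posLog (K : ℝ) ^ s) ∂μ := by
    refine lintegral_mono_ae ?_
    filter_upwards [hae] with j hj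
    refine ENNReal.ofReal_le_ofReal (Real.rpow_le_rpow Real.posLog_nonneg ?_ hs)
    exact Real.posLog_le_posLog (by positivity) (by exact_mod_cast hj.le)
  rw [hμ, lintegral_const, measure_univ, mul_one] at hle
  exact ENNReal.ofReal_ne_top (top_le_iff.1 hle)

theorem l1norm_add_le (x y : Site d) : l1norm (x + y) ≤ l1norm x + l1norm y := by
  unfold l1norm
  rw [← Finset.sum_add_distrib]
  exact Finset.sum_le_sum fun i _ => Int.natAbs_add_le _ _

theorem largeCount_le {c : ℝ} (hc0 : 0 < c) {y : Site d} {j : ℕ} (hj : 0 < j)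
    (h : 2 * Real.log c⁻¹ * l1norm y ≤ Real.log j) : largeCount c y ≤ j := by
  refine Nat.ceil_le.2 ?_
  have hj' : (0 : ℝ) < j := by exact_mod_cast hj
  rw [← Real.log_le_log_iff (by positivity) hj', Real.log_pow]
  push_cast
  linarith

variable [NeZero d]

/-- The paraboloid contains at least `N ^ ((d + 1) / 2)` points of height at most `2 N`. -/
theorem exists_finset_paraboloid (d : ℕ) [NeZero d] (N : ℕ) :
    ∃ F : Finset (Site d), (∀ z ∈ F, z ∈ paraboloid d ∧ z 0 ≤ 2 * N) ∧
      (N : ℝ) ^ (((d : ℝ) + 1) / 2) ≤ F.card := by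
  -- Heights above `N` allow all transverse coordinates up to `√N`, giving `N (⌊√N⌋ + 1) ^ (d - 1)`
  -- points and hence the exponent `1 + (d - 1) / 2`.
  let F : Finset (Site d) := Fintype.piFinset fun i : Fin d =>
    if i = 0 then Finset.Icc (N + 1 : ℤ) (2 * N) else Finset.Icc 0 (Nat.sqrt N : ℤ)
  refine ⟨F, fun z hz => ?_, ?_⟩
  · rw [Fintype.mem_piFinset] at hz
    have h0 := hz 0
    simp only [if_true, Finset.mem_Icc] at h0
    refine ⟨⟨by omega, fun i hi => ?_⟩, h0.2⟩
    have h1 := hz i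
    simp only [hi, if_false, Finset.mem_Icc] at h1
    have h2 : ((Nat.sqrt N : ℕ) : ℤ) ^ 2 ≤ N := by exact_mod_cast Nat.sqrt_le' N
    nlinarith
  · have hcard : F.card = N * (Nat.sqrt N + 1) ^ (d - 1) := by
      rw [Fintype.card_piFinset, ← Finset.mul_prod_erase _ _ (Finset.mem_univ (0 : Fin d)),
        Finset.prod_congr rfl (g := fun _ => Nat.sqrt N + 1) fun i hi => by
          rw [if_neg (Finset.ne_of_mem_erase hi)]; simp]
      simp only [if_true, Int.card_Icc, Finset.prod_const, Finset.card_erase_of_mem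
        (Finset.mem_univ _), Finset.card_univ, Fintype.card_fin]
      congr 1
      omega
    have hd : 1 ≤ d := Nat.one_le_iff_ne_zero.2 (NeZero.ne d)
    rw [hcard]
    rcases Nat.eq_zero_or_pos N with rfl | hN
    · rw [Nat.cast_zero, Real.zero_rpow (by positivity)]
      positivity
    have hN' : (0 : ℝ) < N := by exact_mod_cast hN
    have hsq : √(N : ℝ) ≤ Nat.sqrt N + 1 := by
      rw [Real.sqrt_le_left (by positivity)]
      exact_mod_cast (Nat.lt_succ_sqrt' N).le
    calc (N : ℝ) ^ (((d : ℝ) + 1) / 2) = N * √(N : ℝ) ^ (d - 1) := by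
          rw [Real.sqrt_eq_rpow, ← Real.rpow_natCast, ← Real.rpow_mul hN'.le, Nat.cast_sub hd,
            ← Real.rpow_one_add' hN'.le]
          · congr 1; push_cast; ring
          · have : (1 : ℝ) ≤ d := by exact_mod_cast hd
            push_cast; nlinarith
      _ ≤ N * ((Nat.sqrt N : ℝ) + 1) ^ (d - 1) := by gcongr
      _ = _ := by push_cast; ring

/-- The threshold `largeCount` is exponential in the distance, so `j` frogs are enough at all points
of the paraboloid up to height of order `log j`. There are at least of order `(log j) ^ ((d+1)/2)`
of these, which is where the moment exponent comes from. -/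
theorem exists_posLog_rpow_le_count {c : ℝ} (hc0 : 0 < c) (hc : c ≤ 1 / 2) (x : Site d) :
    ∃ A B : ℝ, 0 ≤ A ∧ 0 ≤ B ∧ ∀ j : ℕ, ∃ F : Finset (Site d),
      (∀ z ∈ F, z ∈ paraboloid d ∧ largeCount c (x + z) ≤ j) ∧
      Real.posLog (j : ℝ) ^ (((d : ℝ) + 1) / 2) ≤ A + B * F.card := by
  set s : ℝ := ((d : ℝ) + 1) / 2
  have hs : 0 < s := by positivity
  have hd : (0 : ℝ) < d := by exact_mod_cast Nat.pos_of_ne_zero (NeZero.ne d)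
  set b : ℝ := 2 * Real.log c⁻¹
  have hb : 0 < b := by
    have : 1 < c⁻¹ := (one_lt_inv₀ hc0).2 (by linarith)
    have := Real.log_pos this
    positivity
  set u : ℝ := b * (l1norm x + 2 * d)
  have hu : 0 ≤ u := by positivity
  refine ⟨2 ^ s * u ^ s, 2 ^ s * (2 * b * d) ^ s, by positivity, by positivity, fun j => ?_⟩
  set L := Real.posLog (j : ℝ)
  have hL0 : 0 ≤ L := Real.posLog_nonneg
  -- Points of height at most `2 N` satisfy `|x + z| ≤ |x| + 2 d N ≤ L / b`. If the quotient is
  -- below one, then `N = 0` and `F` is empty.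
  set N := ⌊(L / b - l1norm x) / (2 * d)⌋₊
  obtain ⟨F, hF, hcard⟩ := exists_finset_paraboloid d N
  refine ⟨F, fun z hz => ⟨(hF z hz).1, ?_⟩, ?_⟩
  · obtain ⟨hzp, hz2⟩ := hF z hz
    have hN : N ≠ 0 := by
      rintro h
      have := hzp.1
      rw [h] at hz2
      simp at hz2
      omega
    have hfloor : (N : ℝ) ≤ (L / b - l1norm x) / (2 * d) :=
      (Nat.le_floor_iff' hN).1 le_rfl
    rw [le_div_iff₀ (by positivity)] at hfloor
    have h1 : (l1norm x : ℝ) + 2 * d * N ≤ L / b := by linarith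
    rw [le_div_iff₀ hb] at h1
    have hN1 : (1 : ℝ) ≤ N := by exact_mod_cast Nat.one_le_iff_ne_zero.2 hN
    have hLpos : 0 < L := lt_of_lt_of_le (by positivity) h1
    have hj : 0 < j := by
      rw [Nat.pos_iff_ne_zero]
      intro h
      simp [L, h] at hLpos
    refine largeCount_le hc0 hj ?_
    have h2 : (l1norm (x + z) : ℝ) ≤ l1norm x + l1norm z := by exact_mod_cast l1norm_add_le x z
    have h3 : (l1norm z : ℝ) ≤ d * z 0 := by exact_mod_cast l1norm_le_of_mem_paraboloid hzp
    have h4 : (z 0 : ℝ) ≤ 2 * N := by exact_mod_cast hz2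
    have h5 : (l1norm (x + z) : ℝ) ≤ l1norm x + 2 * d * N := by nlinarith
    have h6 : L = Real.log j := Real.posLog_eq_log (by
      rw [Nat.abs_cast]; exact_mod_cast hj)
    rw [← h6]
    calc b * l1norm (x + z) ≤ b * (l1norm x + 2 * d * N) := by gcongr
      _ ≤ L := by linarith
  · have hfl := Nat.lt_floor_add_one ((L / b - l1norm x) / (2 * d))
    rw [div_lt_iff₀ (by positivity)] at hfl
    have h1 : L / b ≤ l1norm x + (N + 1) * (2 * d) := by linarith
    rw [div_le_iff₀ hb] at h1
    set v : ℝ := 2 * b * d * N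
    have hv : 0 ≤ v := by positivity
    have h2 : L ≤ u + v := by simp only [u, v]; linarith
    have h3 : u + v ≤ 2 * max u v := by linarith [le_max_left u v, le_max_right u v]
    have h4 : (max u v) ^ s ≤ u ^ s + v ^ s := by
      rcases max_choice u v with h | h <;> rw [h]
      · linarith [Real.rpow_nonneg hv s]
      · linarith [Real.rpow_nonneg hu s]
    calc L ^ s ≤ (2 * max u v) ^ s := Real.rpow_le_rpow hL0 (h2.trans h3) hs.le
      _ = 2 ^ s * (max u v) ^ s := Real.mul_rpow (by norm_num) (le_max_of_le_left hu)
      _ ≤ 2 ^ s * (u ^ s + v ^ s) := by gcongr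
      _ = 2 ^ s * u ^ s + 2 ^ s * (2 * b * d) ^ s * (N : ℝ) ^ s := by
          simp only [v]
          rw [Real.mul_rpow (x := 2 * b * d) (by positivity) (by positivity)]; ring
      _ ≤ _ := by gcongr

/-- By Tonelli, the sum is the `μ`-expectation of the number of sites at which `j` frogs are enough,
which dominates the divergent moment up to constants. -/
theorem tsum_measure_largeCount_eq_top {μ : Measure ℕ} [IsProbabilityMeasure μ]
    (hμ : ∫⁻ j : ℕ, ENNReal.ofReal (Real.posLog (j : ℝ) ^ (((d : ℝ) + 1) / 2)) ∂μ = ⊤)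
    {c : ℝ} (hc0 : 0 < c) (hc : c ≤ 1 / 2) (x : Site d) :
    ∑' z : paraboloid d, μ (Set.Ici (largeCount c (x + (z : Site d)))) = ⊤ := by
  obtain ⟨A, B, hA, hB, hAB⟩ := exists_posLog_rpow_le_count hc0 hc x
  by_contra hfin
  let f : paraboloid d → ℕ → ENNReal := fun z =>
    (Set.Ici (largeCount c (x + (z : Site d)))).indicator 1
  have hf : ∑' z : paraboloid d, μ (Set.Ici (largeCount c (x + (z : Site d)))) =
      ∫⁻ j, ∑' z, f z j ∂μ := by
    rw [lintegral_tsum fun z => Measurable.of_discrete.aemeasurable]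
    refine tsum_congr fun z => ?_
    rw [lintegral_indicator_one .of_discrete]
  have hle : ∀ j : ℕ, ENNReal.ofReal (Real.posLog (j : ℝ) ^ (((d : ℝ) + 1) / 2)) ≤
      ENNReal.ofReal A + ENNReal.ofReal B * ∑' z, f z j := by
    intro j
    obtain ⟨F, hF, hcard⟩ := hAB j
    have hsum : (F.card : ENNReal) ≤ ∑' z, f z j := by
      classical
      calc (F.card : ENNReal) = ∑ z ∈ F.attach, f ⟨z.1, (hF z.1 z.2).1⟩ j := by
            rw [Finset.sum_congr rfl (g := fun _ => (1 : ENNReal)) fun z _ => by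
              simp [f, (hF z.1 z.2).2]]
            simp
        _ = ∑ z ∈ F.attach.map ⟨fun z : F => (⟨z.1, (hF z.1 z.2).1⟩ : paraboloid d),
              fun z z' h => Subtype.ext (congrArg (fun y : paraboloid d => (y : Site d)) h)⟩, f z j := by
            rw [Finset.sum_map]; rfl
        _ ≤ _ := ENNReal.sum_le_tsum _
    calc ENNReal.ofReal (Real.posLog (j : ℝ) ^ (((d : ℝ) + 1) / 2))
        ≤ ENNReal.ofReal (A + B * F.card) := ENNReal.ofReal_le_ofReal hcard
      _ = ENNReal.ofReal A + ENNReal.ofReal B * F.card := by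
          rw [ENNReal.ofReal_add hA (by positivity), ENNReal.ofReal_mul hB, ENNReal.ofReal_natCast]
      _ ≤ _ := by gcongr
  have := lintegral_mono (μ := μ) hle
  rw [hμ, lintegral_add_left measurable_const, lintegral_const, measure_univ, mul_one,
    lintegral_const_mul _ Measurable.of_discrete, ← hf] at this
  exact ENNReal.add_ne_top.2 ⟨ENNReal.ofReal_ne_top,
    ENNReal.mul_ne_top ENNReal.ofReal_ne_top hfin⟩ (top_le_iff.1 this)

theorem infinite_paraboloid : (paraboloid d).Infinite := by
  refine Set.infinite_of_injective_forall_mem (f := fun n : ℕ => (Pi.single 0 (n + 1 : ℤ) : Site d))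
    (fun n m h => ?_) fun n => ⟨?_, fun i hi => ?_⟩
  · have := congrFun h 0
    simpa using this
  · simp only [Pi.single_eq_same]; positivity
  · simp only [Pi.single_eq_same, Pi.single_eq_of_ne hi]; positivity

theorem add_ne_zero_of_mem_paraboloid {x z : Site d} (hx : 0 ≤ x 0) (hz : z ∈ paraboloid d) :
    x + z ≠ 0 := by
  intro h
  have h1 := congrFun h 0
  have h2 := hz.1
  simp only [Pi.add_apply, Pi.zero_apply] at h1
  omega

/-- Every paraboloid contains infinitely many sites with a large number of frogs. -/
theorem ae_infinite_largeCount_le {μ : Measure ℕ} [IsProbabilityMeasure μ]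
    (hμ : ∫⁻ j : ℕ, ENNReal.ofReal (Real.posLog (j : ℝ) ^ (((d : ℝ) + 1) / 2)) ∂μ = ⊤)
    {c : ℝ} (hc0 : 0 < c) (hc : c ≤ 1 / 2) :
    ∀ᵐ η ∂configLaw d μ, ∀ x : Site d, 0 ≤ x 0 →
      {y | y - x ∈ paraboloid d ∧ largeCount c y ≤ frogCount η y}.Infinite := by
  rw [ae_all_iff]
  intro x
  by_cases hx : 0 ≤ x 0
  swap
  · exact Eventually.of_forall fun η h => absurd h hx
  have : Infinite (paraboloid d) := infinite_paraboloid.to_subtype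
  obtain ⟨e⟩ : Nonempty (ℕ ≃ paraboloid d) := by
    obtain ⟨h⟩ := nonempty_denumerable (paraboloid d)
    exact ⟨(Denumerable.eqv (paraboloid d)).symm⟩
  let f : ℕ → {x : Site d // x ≠ 0} := fun n => ⟨x + e n, add_ne_zero_of_mem_paraboloid hx (e n).2⟩
  have hf : Function.Injective f := fun n m h => by
    have h1 : x + (e n : Site d) = x + e m := congrArg Subtype.val h
    exact e.injective (Subtype.ext (add_left_cancel h1))
  have hK : ∑' n, μ (Set.Ici (largeCount c (x + (e n : Site d)))) = ⊤ := by
    rw [e.tsum_eq fun z : paraboloid d => μ (Set.Ici (largeCount c (x + (z : Site d))))]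
    exact tsum_measure_largeCount_eq_top hμ hc0 hc x
  filter_upwards [ae_frequently_le_config μ hf hK] with η hη _
  have hinf := Nat.frequently_atTop_iff_infinite.1 hη
  refine (hinf.image (f := fun n => x + (e n : Site d)) ?_).mono ?_
  · intro n _ m _ h
    exact hf (Subtype.ext h)
  · rintro y ⟨n, hn, rfl⟩
    refine ⟨by simp, ?_⟩
    rw [frogCount_of_ne (add_ne_zero_of_mem_paraboloid hx (e n).2)]
    exact hn

end FrogModel

end

/-! ### Recurrence -/

noncomputable section

namespace FrogModel

open ProbabilityTheory Filter Topology

variable {d : ℕ} [NeZero d]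

/-- The initially active frog first reaches the hyperplane `x_1 = n` at `x`. -/
def ReachesAt (ω : Steps d) (n : ℕ) (x : Site d) : Prop :=
  ∃ t, FirstAt (fun l => ω (0, 0, l)) n t ∧ partialSum (fun l => ω (0, 0, l)) t = x

theorem ReachesAt.first_coordinate {ω : Steps d} {n : ℕ} {x : Site d} (h : ReachesAt ω n x) :
    x 0 = n := by
  obtain ⟨t, hf, rfl⟩ := h
  exact hf.1

theorem ReachesAt.unique {ω : Steps d} {n : ℕ} {x x' : Site d} (h : ReachesAt ω n x)
    (h' : ReachesAt ω n x') : x = x' := by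
  obtain ⟨t, hf, rfl⟩ := h
  obtain ⟨t', hf', rfl⟩ := h'
  rw [hf.unique hf']

theorem ReachesAt.active {η : Config d} {ω : Steps d} {n : ℕ} {x : Site d}
    (h : ReachesAt ω n x) : Active η ω x := by
  obtain ⟨t, -, ht⟩ := h
  exact (active_zero η ω).of_visits (i := 0) (by simp [frogCount]) ⟨t, by rw [walk_eq, ht, zero_add]⟩

theorem measurableSet_reachesAt {I : Set (Coord d)} (hI : ∀ l, Sum.inr (0, 0, l) ∈ I) (n : ℕ)
    (x : Site d) : MeasurableSet[sigmaOf I] {w : Config d × Steps d | ReachesAt w.2 n x} := by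
  have h : MeasurableSet {ξ : ℕ → Site d | ∃ t, FirstAt ξ n t ∧ partialSum ξ t = x} :=
    measurableSet_setOfPred.2 <| Measurable.exists fun t => (measurable_firstAt _ t).and
      (measurableSet_setOfPred.1 (measurable_partialSum t (measurableSet_singleton x)))
  exact measurable_path hI h

/-- The hyperplane `x_1 = n` is the first one, `n ≥ 1`, at whose first visited site `x` the
initially active frog finds at least `M` frogs. -/
def firstCrowded (M n : ℕ) (x : Site d) : Set (Config d × Steps d) :=
  {w | 1 ≤ n ∧ ReachesAt w.2 n x ∧ M ≤ frogCount w.1 x ∧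
    ∀ m x', 1 ≤ m → m < n → ReachesAt w.2 m x' → ¬ M ≤ frogCount w.1 x'}

theorem pairwise_disjoint_firstCrowded (M : ℕ) :
    Pairwise (Function.onFun Disjoint fun k : ℕ × Site d => firstCrowded M k.1 k.2) := by
  rintro ⟨n, x⟩ ⟨n', x'⟩ hne
  refine Set.disjoint_left.2 ?_
  rintro w ⟨hn, hr, hM, hmin⟩ ⟨hn', hr', hM', hmin'⟩
  rcases lt_trichotomy n n' with h | h | h
  · exact hmin' n x hn h hr hM
  · subst h
    exact hne (congrArg (Prod.mk n) (hr.unique hr'))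
  · exact hmin n' x' hn' h hr' hM'

/-- The hyperplane `x_1 = m` is met only at points of height `m`, so only frog counts at heights at
most `n` are inspected. -/
theorem measurableSet_firstCrowded (M n : ℕ) (x : Site d) :
    MeasurableSet[sigmaOf {j | (∃ y, j = Sum.inl y ∧ y.1 0 ≤ n) ∨ ∃ l, j = Sum.inr (0, 0, l)}]
      (firstCrowded M n x) := by
  set I : Set (Coord d) := {j | (∃ y, j = Sum.inl y ∧ y.1 0 ≤ n) ∨ ∃ l, j = Sum.inr (0, 0, l)}
  have hR : ∀ m y, MeasurableSet[sigmaOf I] {w : Config d × Steps d | ReachesAt w.2 m y} :=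
    fun m y => measurableSet_reachesAt (fun l => Or.inr ⟨l, rfl⟩) m y
  have hRM : ∀ m y, m ≤ n → MeasurableSet[sigmaOf I]
      ({w : Config d × Steps d | ReachesAt w.2 m y} ∩ {w | M ≤ frogCount w.1 y}) := by
    intro m y hm
    by_cases hy : y 0 = m
    · refine @MeasurableSet.inter _ (sigmaOf I) _ _ (hR m y) (measurableSet_le_frogCount ?_ M)
      exact fun h => Or.inl ⟨_, rfl, by simp only [hy]; exact_mod_cast hm⟩
    · have : {w : Config d × Steps d | ReachesAt w.2 m y} = ∅ :=
        Set.eq_empty_of_forall_notMem fun w hw => hy hw.first_coordinate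
      rw [this, Set.empty_inter]
      exact @MeasurableSet.empty _ (sigmaOf I)
  have heq : firstCrowded M n x = {_w | 1 ≤ n} ∩
      (({w : Config d × Steps d | ReachesAt w.2 n x} ∩ {w | M ≤ frogCount w.1 x}) ∩
      ⋂ (m : ℕ) (x' : Site d) (_ : 1 ≤ m ∧ m < n),
        ({w : Config d × Steps d | ReachesAt w.2 m x'} ∩ {w | M ≤ frogCount w.1 x'})ᶜ) := by
    ext w
    simp only [firstCrowded, Set.mem_ofPred_eq, Set.mem_inter_iff, Set.mem_iInter,
      Set.mem_compl_iff, not_and, and_assoc, and_imp]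
  rw [heq]
  refine @MeasurableSet.inter _ (sigmaOf I) _ _ (@MeasurableSet.const _ (sigmaOf I) _) ?_
  refine @MeasurableSet.inter _ (sigmaOf I) _ _ (hRM n x le_rfl) ?_
  refine @MeasurableSet.iInter _ _ (sigmaOf I) _ _ fun m => ?_
  refine @MeasurableSet.iInter _ _ (sigmaOf I) _ _ fun y => ?_
  refine @MeasurableSet.iInter _ _ (sigmaOf I) _ _ fun hm => ?_
  exact @MeasurableSet.compl _ _ (sigmaOf I) (hRM m y hm.2.le)

theorem measurableSet_spreadFails (t : Finset (Site d)) (M : ℕ) (x : Site d) :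
    MeasurableSet[sigmaOf {j | (∃ y, j = Sum.inl y ∧ x 0 < y.1 0) ∨
      ∃ s, j = Sum.inr s ∧ x 0 ≤ s.1 0}] (spreadFails t M x) := by
  set I : Set (Coord d) := {j | (∃ y, j = Sum.inl y ∧ x 0 < y.1 0) ∨
      ∃ s, j = Sum.inr s ∧ x 0 ≤ s.1 0}
  have hV : ∀ y i v, x 0 ≤ y 0 →
      MeasurableSet[sigmaOf I] {w : Config d × Steps d | Visits w.2 y i v} :=
    fun y i v hy => measurableSet_visits (fun l => Or.inr ⟨_, rfl, hy⟩) v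
  refine @MeasurableSet.union _ (sigmaOf I) _ _ ?_ ?_
  · refine @Finset.measurableSet_biUnion _ _ (sigmaOf I) _ _ fun z _ => ?_
    simp only [Set.ofPred_forall]
    refine @MeasurableSet.iInter _ _ (sigmaOf I) _ _ fun i => ?_
    refine @MeasurableSet.iInter _ _ (sigmaOf I) _ _ fun _ => ?_
    exact @MeasurableSet.compl _ _ (sigmaOf I) (hV x i _ le_rfl)
  · refine @MeasurableSet.biUnion _ _ (sigmaOf I) _ _ (Set.to_countable _) fun z _ => ?_
    simp only [unreached, Set.ofPred_forall]
    refine @MeasurableSet.iInter _ _ (sigmaOf I) _ _ fun y => ?_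
    refine @MeasurableSet.iInter _ _ (sigmaOf I) _ _ fun hy => ?_
    refine @MeasurableSet.iInter _ _ (sigmaOf I) _ _ fun _ => ?_
    have hy0 := hy.1
    refine @MeasurableSet.compl _ _ (sigmaOf I) (@MeasurableSet.inter _ (sigmaOf I) _ _
      (measurableSet_le_frogCount (fun h => Or.inl ⟨_, rfl, ?_⟩) 1) (hV _ _ _ ?_))
    · simp only [Pi.add_apply]; omega
    · simp only [Pi.add_apply]; omega

/-- The frog count at `x` itself belongs to the first event only: the second speaks of the first `M`
walks from `x` whether or not those frogs exist. The initial frog starts at height `0 < n`, so its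
steps are not used by the second event. -/
theorem annealed_firstCrowded_inter (p : PMF (Site d)) (μ : Measure ℕ) [IsProbabilityMeasure μ]
    (t : Finset (Site d)) (M n : ℕ) (x : Site d) :
    annealed p μ (firstCrowded M n x ∩ spreadFails t M x) =
      annealed p μ (firstCrowded M n x) * annealed p μ (spreadFails t M x) := by
  by_cases h : 1 ≤ n ∧ x 0 = n
  · refine measure_inter_of_disjoint p μ (Set.disjoint_left.2 ?_) (measurableSet_firstCrowded M n x)
      (measurableSet_spreadFails t M x)
    rintro j (⟨y, rfl, hy⟩ | ⟨l, rfl⟩) (⟨y', h1, hy'⟩ | ⟨s, h1, hs⟩)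
    · obtain rfl := Sum.inl.inj h1
      omega
    · simp at h1
    · simp at h1
    · obtain rfl := Sum.inr.inj h1
      simp only [Pi.zero_apply] at hs
      omega
  · have : firstCrowded M n x = ∅ := Set.eq_empty_of_forall_notMem fun w hw =>
      h ⟨hw.1, hw.2.1.first_coordinate⟩
    simp [this]

/-- The initially active frog meets sites with arbitrarily many frogs. -/
theorem ae_exists_firstCrowded {p : PMF (Site d)} {a : ℝ} (hp : IsRightDriftStep p a)
    (μ : Measure ℕ) [IsProbabilityMeasure μ] (M : ℕ) (hM : 0 < μ (Set.Ici M)) :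
    ∀ᵐ w ∂annealed p μ, ∃ n x, w ∈ firstCrowded M n x := by
  -- With the steps fixed, the first points on successive hyperplanes are deterministic distinct
  -- sites with i.i.d. frog counts, so Borel-Cantelli applies; Fubini then exchanges the order of
  -- the two variables.
  have hω : ∀ᵐ ω ∂stepsLaw p, ∀ᵐ η ∂configLaw d μ,
      ∃ n x, 1 ≤ n ∧ ReachesAt ω n x ∧ M ≤ frogCount η x := by
    have h := (measurePreserving_path p (0 : Site d) 0).quasiMeasurePreserving.ae
      (ae_exists_firstAt hp)
    filter_upwards [h] with ω hω
    have hY : ∀ n : ℕ, ∃ x, ReachesAt ω (n + 1) x := by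
      intro n
      obtain ⟨t, ht⟩ := hω ((n + 1 : ℕ) : ℤ) (by push_cast; omega)
      exact ⟨_, t, ht, rfl⟩
    choose Y hY using hY
    have hne : ∀ n, Y n ≠ 0 := by
      intro n h
      have := (hY n).first_coordinate
      rw [h] at this
      simp only [Pi.zero_apply] at this
      omega
    have hinj : Function.Injective fun n => (⟨Y n, hne n⟩ : {x : Site d // x ≠ 0}) := by
      intro n m h
      have h1 : Y n = Y m := congrArg Subtype.val h
      have h2 := (hY n).first_coordinate
      rw [h1, (hY m).first_coordinate] at h2
      omega
    filter_upwards [ae_frequently_le_config μ hinj (K := fun _ => M)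
      (ENNReal.tsum_const_eq_top_of_ne_zero hM.ne')] with η hη
    obtain ⟨n, hn⟩ := hη.exists
    exact ⟨n + 1, Y n, by omega, hY n, by rw [frogCount_of_ne (hne n)]; exact hn⟩
  have hmeas : MeasurableSet {w : Config d × Steps d |
      ∃ n x, 1 ≤ n ∧ ReachesAt w.2 n x ∧ M ≤ frogCount w.1 x} := by
    simp only [Set.ofPred_exists]
    refine MeasurableSet.iUnion fun n => MeasurableSet.iUnion fun x => ?_
    refine MeasurableSet.inter (MeasurableSet.const _) (MeasurableSet.inter ?_ ?_)
    · exact sigmaOf_le Set.univ _ (measurableSet_reachesAt (fun _ => Set.mem_univ _) n x)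
    · exact sigmaOf_le Set.univ _ (measurableSet_le_frogCount (fun _ => Set.mem_univ _) M)
  have hae : ∀ᵐ w ∂annealed p μ, ∃ n x, 1 ≤ n ∧ ReachesAt w.2 n x ∧ M ≤ frogCount w.1 x := by
    rw [annealed_eq_prod]
    refine (Measure.ae_prod_iff_ae_ae hmeas).2 ?_
    exact (Measure.ae_ae_comm (μ := configLaw d μ) (ν := stepsLaw p)
      (p := fun η ω => ∃ n x, 1 ≤ n ∧ ReachesAt ω n x ∧ M ≤ frogCount η x) hmeas).2 hω
  filter_upwards [hae] with w hw
  classical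
  obtain ⟨x, hx⟩ := Nat.find_spec hw
  exact ⟨Nat.find hw, x, hx.1, hx.2.1, hx.2.2, fun m x' hm hlt hr hc =>
    Nat.find_min hw hlt ⟨x', hm, hr, hc⟩⟩

/-- Almost surely all sites of some paraboloid are activated. -/
theorem ae_exists_active_paraboloid {p : PMF (Site d)} {a : ℝ} (hp : IsRightDriftStep p a)
    (μ : Measure ℕ) [IsProbabilityMeasure μ] (hμ : ∀ M, 0 < μ (Set.Ici M)) :
    ∀ᵐ w ∂annealed p μ, ∃ x : Site d, 0 ≤ x 0 ∧ ∀ z ∈ paraboloid d, Active w.1 w.2 (x + z) := by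
  rw [ae_iff]
  refine le_antisymm (le_of_forall_gt_imp_ge_of_dense fun δ hδ => ?_) zero_le
  obtain ⟨t, M, hF⟩ := exists_annealed_spreadFails_le hp μ
    (ENNReal.toReal_pos (hμ 1).ne' (measure_ne_top _ _)) hδ
  -- Decomposition according to the first crowded site. The pieces are disjoint, and each fails to
  -- spread with conditional probability at most `δ`, so the total failure probability is at most
  -- `δ`.
  let Q : ℕ × Site d → Set (Config d × Steps d) := fun k => firstCrowded M k.1 k.2
  have hQm : ∀ k, MeasurableSet (Q k) := fun k =>
    sigmaOf_le _ _ (measurableSet_firstCrowded M k.1 k.2)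
  calc annealed p μ {w | ¬ ∃ x : Site d, 0 ≤ x 0 ∧ ∀ z ∈ paraboloid d, Active w.1 w.2 (x + z)}
      ≤ annealed p μ (⋃ k, Q k ∩ spreadFails t M k.2) := by
        refine measure_mono_ae ?_
        filter_upwards [ae_exists_firstCrowded hp μ M (hμ M)] with w hw hbad
        obtain ⟨n, x, hQ⟩ := hw
        refine Set.mem_iUnion.2 ⟨(n, x), hQ, ?_⟩
        by_contra hs
        refine hbad ⟨x, by rw [hQ.2.1.first_coordinate]; positivity, fun z hz => ?_⟩
        exact active_of_notMem_spreadFails hQ.2.1.active hQ.2.2.1 hs hz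
    _ ≤ ∑' k, annealed p μ (Q k ∩ spreadFails t M k.2) := measure_iUnion_le _
    _ ≤ ∑' k, annealed p μ (Q k) * δ := by
        refine ENNReal.tsum_le_tsum fun k => ?_
        by_cases hk : 0 ≤ k.2 0
        · rw [annealed_firstCrowded_inter]
          gcongr
          exact hF k.2 hk
        · have : Q k = ∅ := Set.eq_empty_of_forall_notMem fun w hw => hk (by
            rw [hw.2.1.first_coordinate]; positivity)
          simp [this]
    _ = annealed p μ (⋃ k, Q k) * δ := by
        rw [ENNReal.tsum_mul_right, measure_iUnion (pairwise_disjoint_firstCrowded M) hQm]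
    _ ≤ δ := mul_le_of_le_one_left zero_le prob_le_one

end FrogModel

end

theorem theorem1 (d : ℕ) [NeZero d] (p : PMF (FrogModel.Site d)) (a : ℝ)
    (hp : FrogModel.IsRightDriftStep p a) (μ : Measure ℕ) [IsProbabilityMeasure μ]
    (hμ : ∫⁻ j : ℕ, ENNReal.ofReal (Real.posLog (j : ℝ) ^ (((d : ℝ) + 1) / 2)) ∂μ = ⊤) :
    FrogModel.annealed p μ (FrogModel.originVisitedInfinitelyOften d) = 1 := by
  obtain ⟨c, hc0, hc, hcp⟩ := FrogModel.exists_step_lower_bound hp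
  have h1 := FrogModel.ae_exists_active_paraboloid hp μ
    (FrogModel.measure_Ici_pos (by positivity) hμ)
  have h2 := FrogModel.ae_finite_not_visits_zero p μ hc0 hc hcp
  have h3 : ∀ᵐ w ∂FrogModel.annealed p μ, ∀ x : FrogModel.Site d, 0 ≤ x 0 →
      {y | y - x ∈ FrogModel.paraboloid d ∧
        FrogModel.largeCount c y ≤ FrogModel.frogCount w.1 y}.Infinite := by
    rw [FrogModel.annealed_eq_prod]
    exact Measure.quasiMeasurePreserving_fst.ae (FrogModel.ae_infinite_largeCount_le hμ hc0 hc)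
  have hae : ∀ᵐ w ∂FrogModel.annealed p μ, w ∈ FrogModel.originVisitedInfinitelyOften d := by
    filter_upwards [h1, h2, h3] with w hw1 hw2 hw3
    obtain ⟨x, hx0, hx⟩ := hw1
    -- The active paraboloid has infinitely many sites above the threshold, of which only finitely
    -- many fail to send a frog to the origin.
    refine FrogModel.infinite_visitedAt_zero (((hw3 x hx0).sdiff hw2).mono ?_)
    rintro y ⟨⟨hy, hcount⟩, hvis⟩
    simp only [Set.mem_ofPred_eq, not_forall, not_not] at hvis
    obtain ⟨i, hi, hv⟩ := hvis
    refine ⟨?_, i, hi.trans_le hcount, hv⟩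
    simpa using hx _ hy
  exact (measure_congr (t := Set.univ) (Filter.eventuallyEq_univ.2 hae)).trans measure_univ
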